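/- For points $a,b,c\in\mathbb R^2$ the orientation of $(a,b,c)$ is the sign of $\det\begin{pmatrix}a_x&b_x&c_x\\a_y&b_y&c_y\\1&1&1\end{pmatrix}$, and the chirotope of a sequence $P=(p_1,\dots,p_n)$ of points of the plane is the map that sends $(i,j,k)$ to the orientation of $(p_i,p_j,p_k)$. A sequence of points of $[0,1]^2$ is given as $2n$ infinite binary strings, one binary expansion for each coordinate of each point. A (deterministic) algorithm chooses at each step, depending on the bits read so far, either a coordinate of a point, whose next bit (in order, starting from the most significant one) it then reads at unit cost, or it stops and announces a chirotope; all other computations are free. Let $P$ be a sequence of $n$ points drawn independently and uniformly in $[0,1]^2$. An algorithm determines the chirotope of $P$ if almost surely it stops and announces the chirotope of $P$. The greedy method reads bits as follows. At any time the known bits of $p_i$ determine a closed dyadic square cell that contains $p_i$ (initially $[0,1]^2$). As long as there are distinct indices $a,b,c$ such that some line meets the three cells known to contain $p_a,p_b,p_c$, it picks such a triple and, among its three points, one with the fewest known bits, and reads one more bit of both coordinates of this point (first $x$, then $y$); ties are broken arbitrarily. When there is no such triple, it stops and announces the chirotope, which is then the same for all sequences of points in the known cells. Theorem. Logarithms are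 to base $2$. (i) There is a constant $C$ such that for every $n\ge 3$, every algorithm that determines the chirotope of $P$ reads on average at least $4n\log n-C\,n\log\log n$ coordinate bits. (ii) There is a (Turing-computable, uniformly in $n$) algorithm that follows the greedy method. Moreover, for every $n\ge 0$, every algorithm that follows the greedy method, whatever its rule to break ties, determines the chirotope of $P$, stops with the right chirotope on every input in which no three points are aligned, and reads on average at most $4n\log n+16n$ coordinate bits (where $0\log 0=0$), hence $4n\log n+O(n)$. -/

import Mathlib

open MeasureTheory
open scoped ENNReal

namespace BitModel

noncomputable section

/-! ### Orientations and chirotopes -/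

/-- The orientation of a triple of points of the plane: `1` if the triangle is oriented
counterclockwise, `-1` if it is oriented clockwise, `0` if it is flat. -/
def orientation (a b c : Fin 2 → ℝ) : SignType :=
  SignType.sign (Matrix.det !![a 0, b 0, c 0; a 1, b 1, c 1; 1, 1, 1])

/-- The type of all assignments of a sign to each triple of indices. -/
abbrev Signs (n : ℕ) : Type := Fin n → Fin n → Fin n → SignType

/-- The chirotope of a sequence of `n` points: the orientations of all its triples.
Two sequences have the same chirotope (as an equivalence class) iff these functions agree. -/
def chirotope {n : ℕ} (P : Fin n → Fin 2 → ℝ) : Signs n :=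
  fun i j k => orientation (P i) (P j) (P k)

/-- No three points (with distinct indices) are aligned. -/
def InGeneralPosition {n : ℕ} (P : Fin n → Fin 2 → ℝ) : Prop :=
  ∀ i j k : Fin n, i ≠ j → j ≠ k → i ≠ k → chirotope P i j k ≠ 0

/-! ### Uniform samples and binary expansions -/

/-- The uniform distribution on the unit square. -/
def uniformSquare : Measure (Fin 2 → ℝ) := volume.restrict (Set.Icc 0 1)

/-- The law of a uniform sample of size `n`: `n` independent uniform points of `[0,1]²`. -/
def uniformSample (n : ℕ) : Measure (Fin n → Fin 2 → ℝ) :=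
  Measure.pi fun _ => uniformSquare

/-- The binary digits of `x ∈ [0,1]` after the point, the most significant one first.
The real `1` is written `0.111…`. -/
def bits (x : ℝ) : ℕ → Fin 2 :=
  if x = 1 then fun _ => 1 else Real.digits x 2

/-- An input: `2 n` infinite binary strings, one per point and coordinate. -/
abbrev Input (n : ℕ) : Type := Fin n → Fin 2 → ℕ → Fin 2

/-- The points described by an input. Either expansion of a dyadic number may be used. -/
def Input.points {n : ℕ} (w : Input n) : Fin n → Fin 2 → ℝ :=
  fun i c => Real.ofDigits (w i c)

/-- The input that describes a sequence of points of `[0,1]²`. -/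
def inputOf {n : ℕ} (P : Fin n → Fin 2 → ℝ) : Input n := fun i c => bits (P i c)

/-! ### Algorithms that read coordinate bits -/

/-- What has been read so far: a finite prefix of each of the `2 n` strings. -/
abbrev Knowledge (n : ℕ) : Type := Fin n → Fin 2 → List (Fin 2)

/-- What an algorithm can do: read the next bit of coordinate `c` of point `i`
(at unit cost), or stop and announce a chirotope. -/
inductive Action (n : ℕ) : Type
  | read (i : Fin n) (c : Fin 2) : Action n
  | output (χ : Signs n) : Action n

/-- A deterministic algorithm, up to the computations that it performs for free: its next action
is a function of what it has read. (Along the runs of a deterministic algorithm the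
prefixes that are known determine the order in which they were read, so nothing is lost by
letting the next action depend on the prefixes alone.) -/
abbrev Algorithm (n : ℕ) : Type := Knowledge n → Action n

/-- The knowledge of the algorithm `A` on the input `w` after `t` steps; it does not change once
`A` has stopped. -/
def knowledge {n : ℕ} (A : Algorithm n) (w : Input n) : ℕ → Knowledge n
  | 0 => fun _ _ => []
  | t + 1 =>
    match A (knowledge A w t) with
    | Action.read i c => fun j d =>
        if j = i ∧ d = c then
          knowledge A w t j d ++ [w j d (knowledge A w t j d).length]
        else knowledge A w t j d
    | Action.output _ => knowledge A w t

/-- On the input `w`, the algorithm `A` stops and announces `χ`. -/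
def Outputs {n : ℕ} (A : Algorithm n) (w : Input n) (χ : Signs n) : Prop :=
  ∃ t, A (knowledge A w t) = Action.output χ

/-- The total number of coordinate bits that `A` reads on the input `w`
(`∞` if `A` does not stop). -/
def bitsRead {n : ℕ} (A : Algorithm n) (w : Input n) : ℝ≥0∞ :=
  ⨆ t : ℕ, ((∑ i, ∑ c, (knowledge A w t i c).length : ℕ) : ℝ≥0∞)

/-- The average number of coordinate bits that `A` reads on a uniform sample of size `n`. -/
def averageBits {n : ℕ} (A : Algorithm n) : ℝ≥0∞ :=
  ∫⁻ P, bitsRead A (inputOf P) ∂(uniformSample n)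

/-- The algorithm `A` determines the chirotope of a uniform sample: almost surely, it stops and
announces the right chirotope. -/
def DeterminesChirotope {n : ℕ} (A : Algorithm n) : Prop :=
  ∀ᵐ P ∂(uniformSample n), Outputs A (inputOf P) (chirotope P)

/-- An action as a finite piece of data. -/
def Action.code {n : ℕ} : Action n → (ℕ × ℕ) ⊕ List (List (List ℤ))
  | Action.read i c => Sum.inl ((i : ℕ), (c : ℕ))
  | Action.output χ => Sum.inr
      (List.ofFn fun i => List.ofFn fun j => List.ofFn fun k => ((χ i j k : SignType) : ℤ))

/-- A family of algorithms, one for each size, is computable if a single Turing-computable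
function, applied to the list of the pairs of known prefixes, gives the next action. -/
def UniformlyComputable (A : ∀ n, Algorithm n) : Prop :=
  ∃ f : List (List (Fin 2) × List (Fin 2)) → (ℕ × ℕ) ⊕ List (List (List ℤ)),
    Computable f ∧
    ∀ (n : ℕ) (K : Knowledge n), f (List.ofFn fun i => (K i 0, K i 1)) = (A n K).code

/-! ### The greedy method -/

/-- The dyadic number `0.b₁b₂…bₖ` of a finite binary string. -/
def prefixValue : List (Fin 2) → ℝ
  | [] => 0
  | b :: u => (((b : ℕ) : ℝ) + prefixValue u) / 2

/-- The cell known to contain point `i`: all points of the square whose coordinates have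
binary expansions that start with the known prefixes. -/
def knownCell {n : ℕ} (K : Knowledge n) (i : Fin n) : Set (Fin 2 → ℝ) :=
  {p | ∀ c, p c ∈ Set.Icc (prefixValue (K i c))
    (prefixValue (K i c) + (1 / 2 : ℝ) ^ (K i c).length)}

/-- The three indices are distinct and some line `{x + t • v}` meets the three cells known to
contain the points. -/
def Unresolved {n : ℕ} (K : Knowledge n) (a b c : Fin n) : Prop :=
  a ≠ b ∧ b ≠ c ∧ a ≠ c ∧
    ∃ x v : Fin 2 → ℝ, v ≠ 0 ∧
      (∃ t : ℝ, x + t • v ∈ knownCell K a) ∧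
      (∃ t : ℝ, x + t • v ∈ knownCell K b) ∧
      (∃ t : ℝ, x + t • v ∈ knownCell K c)

/-- For each point, equally many bits of its two coordinates are known. -/
def Balanced {n : ℕ} (K : Knowledge n) : Prop :=
  ∀ i, (K i 0).length = (K i 1).length

/-- `A` follows the greedy method, with any rule to break ties: as long as there is an unresolved
triple, it selects a point of coarsest resolution in some unresolved triple
and reads one more bit of both coordinates of this point; when there is none, it
stops and announces the chirotope common to all sequences of points that agree with what is
known. -/
structure IsGreedy {n : ℕ} (A : Algorithm n) : Prop where
  select : ∀ K : Knowledge n, Balanced K → (∃ a b c, Unresolved K a b c) →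
    ∃ a b c, Unresolved K a b c ∧
      (K a 0).length ≤ (K b 0).length ∧ (K a 0).length ≤ (K c 0).length ∧
      A K = Action.read a 0
  second : ∀ (K : Knowledge n) (i : Fin n), (K i 0).length = (K i 1).length + 1 →
    (∀ j, j ≠ i → (K j 0).length = (K j 1).length) → A K = Action.read i 1
  finish : ∀ K : Knowledge n, Balanced K → (¬ ∃ a b c, Unresolved K a b c) →
    ∃ χ : Signs n, A K = Action.output χ ∧
      ∀ P : Fin n → Fin 2 → ℝ, (∀ i, P i ∈ knownCell K i) → chirotope P = χ

end

end BitModel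

open BitModel

/-! Upper bound. The greedy method reads the bits of rank `r` (counted from 0) of a point only when
this point is the coarsest of an unresolved triple, hence only when it lies, with two other points,
within `2^(-r)` of a common line (`Unresolved.nearLine`, `IsGreedy.invariant`). Among three such
points, one is `4 * 2^(-r)`-close, along an axis, to the line through the other two
(`NearLine.exists_interpolate`). A union bound over the other two points gives probability `O(n^2
2^(-r))`, and summing the minimum of 1 and this bound over `r` gives `2 log n + O(1)` for each of
the `2n` coordinates (`tsum_min_one_geometric_le`).

Lower bound. If an algorithm stops knowing at most `k` bits of a coordinate of a point, this point
may slide along a dyadic segment of length `δ = 2^(-k)` without changing the run. A line through two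
other points that crosses the segment makes both orientations possible, each with positive
probability, so the announced chirotope cannot be almost surely right
(`DeterminesChirotope.lt_length_of_crosses`). The expected number of crossing lines is of order `n^2
δ`, and the events for pairs without a common point are independent. The second moment method then
shows that all lines miss the segment with probability `O(1/(n^2 δ))` as long as `n δ` is bounded
(`measure_forall_not_crosses_le`). Taking `δ` of order `log n / n^2` makes this `O(1/log n)`, at the
price of `log log n` bits per coordinate.

Computability. A triple is unresolved iff the signed area vanishes somewhere on the product of its
cells. The cells are connected and the area is affine in each coordinate, so this is decided by its
signs at the 64 choices of corners, which integer arithmetic computes (`ambiguous_iff_unresolved`).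
-/

namespace BitModel

/-! ### Finite prefixes of binary strings and dyadic intervals -/

/-- The first `k` letters of the infinite string `s`. -/
def streamPrefix (s : ℕ → Fin 2) (k : ℕ) : List (Fin 2) := (List.range k).map s

@[simp] lemma length_streamPrefix (s : ℕ → Fin 2) (k : ℕ) : (streamPrefix s k).length = k := by
  simp [streamPrefix]

lemma streamPrefix_succ (s : ℕ → Fin 2) (k : ℕ) :
    streamPrefix s (k + 1) = streamPrefix s k ++ [s k] := by
  simp [streamPrefix, List.range_succ]

lemma streamPrefix_eq_iff {s s' : ℕ → Fin 2} {k : ℕ} :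
    streamPrefix s k = streamPrefix s' k ↔ ∀ j < k, s j = s' j := by
  simp [streamPrefix]

lemma prefixValue_append_singleton (u : List (Fin 2)) (b : Fin 2) :
    prefixValue (u ++ [b]) = prefixValue u + ((b : ℕ) : ℝ) * (1 / 2) ^ (u.length + 1) := by
  induction u with
  | nil => simp [prefixValue]; ring
  | cons a u ih => simp only [List.cons_append, prefixValue, ih, List.length_cons]; ring

lemma prefixValue_streamPrefix (s : ℕ → Fin 2) (k : ℕ) :
    prefixValue (streamPrefix s k) = ∑ i ∈ Finset.range k, Real.ofDigitsTerm s i := by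
  induction k with
  | zero => simp [streamPrefix, prefixValue]
  | succ k ih =>
    rw [streamPrefix_succ, prefixValue_append_singleton, ih, Finset.sum_range_succ,
      length_streamPrefix, Real.ofDigitsTerm]
    simp

lemma ofDigits_eq_prefixValue_add (s : ℕ → Fin 2) (k : ℕ) :
    Real.ofDigits s = prefixValue (streamPrefix s k) +
      (1 / 2) ^ k * Real.ofDigits fun i => s (i + k) := by
  rw [prefixValue_streamPrefix, Real.ofDigits_eq_sum_add_ofDigits s k]
  simp

lemma ofDigits_mem_prefix (s : ℕ → Fin 2) (k : ℕ) :
    Real.ofDigits s ∈ Set.Icc (prefixValue (streamPrefix s k))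
      (prefixValue (streamPrefix s k) + (1 / 2 : ℝ) ^ k) := by
  have h0 := Real.ofDigits_nonneg fun i => s (i + k)
  have h1 := Real.ofDigits_le_one fun i => s (i + k)
  have h2 : (0 : ℝ) < (1 / 2) ^ k := by positivity
  rw [ofDigits_eq_prefixValue_add s k]
  constructor <;> nlinarith

lemma ofDigits_bits {x : ℝ} (hx : x ∈ Set.Icc 0 1) : Real.ofDigits (bits x) = x := by
  unfold bits
  split_ifs with h
  · have := Real.ofDigits_const_last_eq_one' (b := 2) (by norm_num)
    rw [h]; simpa using this
  · exact Real.ofDigits_digits (by norm_num) ⟨hx.1, lt_of_le_of_ne hx.2 h⟩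

lemma prefixValue_nonneg (u : List (Fin 2)) : 0 ≤ prefixValue u := by
  induction u with
  | nil => simp [prefixValue]
  | cons a u ih => simp only [prefixValue]; positivity

lemma prefixValue_add_le_one (u : List (Fin 2)) :
    prefixValue u + (1 / 2 : ℝ) ^ u.length ≤ 1 := by
  induction u with
  | nil => simp [prefixValue]
  | cons a u ih =>
    have : ((a : ℕ) : ℝ) ≤ 1 := by exact_mod_cast Nat.le_of_lt_succ a.2
    simp only [prefixValue, List.length_cons, pow_succ]
    linarith

/-- A real number in the open dyadic interval of a finite string has an expansion starting with
this string. -/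
lemma streamPrefix_bits_of_mem_Ioo {x : ℝ} {u : List (Fin 2)}
    (hx : x ∈ Set.Ioo (prefixValue u) (prefixValue u + (1 / 2 : ℝ) ^ u.length)) :
    streamPrefix (bits x) u.length = u := by
  induction u using List.reverseRecOn with
  | nil => simp [streamPrefix]
  | append_singleton u b ih =>
    have hlen : (u ++ [b]).length = u.length + 1 := by simp
    have hb : ((b : ℕ) : ℝ) ≤ 1 := by exact_mod_cast Nat.le_of_lt_succ b.2
    have hb0 : (0 : ℝ) ≤ ((b : ℕ) : ℝ) := by positivity
    have hp : (0 : ℝ) < (1 / 2) ^ u.length := by positivity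
    have hbd := prefixValue_add_le_one (u ++ [b])
    have hx1 : x < 1 := lt_of_lt_of_le hx.2 hbd
    have hx0 : 0 ≤ x := (prefixValue_nonneg _).trans hx.1.le
    rw [prefixValue_append_singleton, hlen, pow_succ] at hx
    have hx' : x ∈ Set.Ioo (prefixValue u) (prefixValue u + (1 / 2 : ℝ) ^ u.length) :=
      ⟨by nlinarith [hx.1], by nlinarith [hx.2]⟩
    have ih' := ih hx'
    rw [hlen, streamPrefix_succ, ih']
    congr 2
    -- The number `x` lies in the open interval selected by `b` and in the closed one selected by
    -- its actual digit `c`, so these digits differ by less than 1. At an end point the other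
    -- expansion could have been chosen.
    have hm := ofDigits_mem_prefix (bits x) (u.length + 1)
    rw [ofDigits_bits ⟨hx0, hx1.le⟩, streamPrefix_succ, ih', prefixValue_append_singleton,
      pow_succ] at hm
    set c := bits x u.length with hc
    have h1 : ((b : ℕ) : ℝ) < ((c : ℕ) : ℝ) + 1 := by
      have := hm.2; have := hx.1; nlinarith
    have h2 : ((c : ℕ) : ℝ) < ((b : ℕ) : ℝ) + 1 := by
      have := hm.1; have := hx.2; nlinarith
    have h1' : (b : ℕ) < (c : ℕ) + 1 := by exact_mod_cast h1
    have h2' : (c : ℕ) < (b : ℕ) + 1 := by exact_mod_cast h2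
    ext; omega

lemma streamPrefix_Icc_anti (s : ℕ → Fin 2) {k l : ℕ} (h : k ≤ l) :
    prefixValue (streamPrefix s k) ≤ prefixValue (streamPrefix s l) ∧
    prefixValue (streamPrefix s l) + (1 / 2 : ℝ) ^ l ≤
      prefixValue (streamPrefix s k) + (1 / 2 : ℝ) ^ k := by
  induction l, h using Nat.le_induction with
  | base => simp
  | succ l _ ih =>
    rw [streamPrefix_succ, prefixValue_append_singleton, length_streamPrefix]
    have hb : (((s l : Fin 2) : ℕ) : ℝ) ≤ 1 := by exact_mod_cast Nat.le_of_lt_succ (s l).2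
    have hb0 : (0 : ℝ) ≤ (((s l : Fin 2) : ℕ) : ℝ) := by positivity
    have hp : (0 : ℝ) < (1 / 2) ^ l := by positivity
    rw [pow_succ]
    constructor <;> nlinarith [ih.1, ih.2]

lemma measurable_bits (k : ℕ) : Measurable fun x : ℝ => bits x k := by
  unfold bits
  have : (fun x : ℝ => (if x = 1 then fun _ => (1 : Fin 2) else Real.digits x 2) k) =
      fun x : ℝ => if x = 1 then (1 : Fin 2) else Fin.ofNat 2 ⌊x * 2 ^ (k + 1)⌋₊ := by
    funext x; split_ifs <;> simp [Real.digits]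
  rw [this]
  refine Measurable.ite (measurableSet_eq_fun measurable_id measurable_const) measurable_const ?_
  exact (measurable_of_countable (Fin.ofNat 2)).comp
    (Nat.measurable_floor.comp (measurable_id.mul_const _))

/-- The left end of the dyadic interval of length `2 ^ (-k)` around `x`. -/
noncomputable def dyadicFloor (k : ℕ) (x : ℝ) : ℝ := prefixValue (streamPrefix (bits x) k)

lemma measurable_dyadicFloor (k : ℕ) : Measurable (dyadicFloor k) := by
  unfold dyadicFloor
  simp_rw [prefixValue_streamPrefix, Real.ofDigitsTerm]
  refine Finset.measurable_sum _ fun i _ => Measurable.mul_const ?_ _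
  exact (measurable_of_countable fun b : Fin 2 => ((b : ℕ) : ℝ)).comp (measurable_bits i)

lemma dyadicFloor_nonneg (k : ℕ) (x : ℝ) : 0 ≤ dyadicFloor k x := prefixValue_nonneg _

lemma dyadicFloor_add_le_one (k : ℕ) (x : ℝ) : dyadicFloor k x + (1 / 2 : ℝ) ^ k ≤ 1 := by
  simpa [dyadicFloor] using prefixValue_add_le_one (streamPrefix (bits x) k)

/-! ### Runs of algorithms -/

variable {n : ℕ}

/-- Knowledge is thus determined by the input and the lengths alone: to compare two runs it suffices
to compare lengths and prefixes. -/
lemma knowledge_eq_streamPrefix (A : Algorithm n) (w : Input n) (t : ℕ) (i : Fin n) (c : Fin 2) :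
    knowledge A w t i c = streamPrefix (w i c) (knowledge A w t i c).length := by
  induction t with
  | zero => simp [knowledge, streamPrefix]
  | succ t ih =>
    simp only [knowledge]
    cases h : A (knowledge A w t) with
    | output χ => simpa using ih
    | read j d =>
      simp only
      split_ifs with hc
      · rw [List.length_append, List.length_singleton, streamPrefix_succ, ← ih]
      · exact ih

lemma length_knowledge_succ (A : Algorithm n) (w : Input n) (t : ℕ) {j : Fin n} {d : Fin 2}
    (h : A (knowledge A w t) = Action.read j d) (i : Fin n) (c : Fin 2) :
    (knowledge A w (t + 1) i c).length =
      (knowledge A w t i c).length + if i = j ∧ c = d then 1 else 0 := by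
  simp only [knowledge, h]
  split_ifs <;> simp

lemma knowledge_succ_of_output (A : Algorithm n) (w : Input n) (t : ℕ) {χ : Signs n}
    (h : A (knowledge A w t) = Action.output χ) : knowledge A w (t + 1) = knowledge A w t := by
  simp only [knowledge, h]

lemma knowledge_of_output (A : Algorithm n) (w : Input n) {t s : ℕ} {χ : Signs n}
    (h : A (knowledge A w t) = Action.output χ) (hs : t ≤ s) :
    knowledge A w s = knowledge A w t := by
  induction s, hs using Nat.le_induction with
  | base => rfl
  | succ s _ ih => rw [knowledge_succ_of_output A w s (χ := χ) (by rw [ih, h]), ih]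

lemma Outputs.unique {A : Algorithm n} {w : Input n} {χ χ' : Signs n}
    (h : Outputs A w χ) (h' : Outputs A w χ') : χ = χ' := by
  obtain ⟨t, ht⟩ := h
  obtain ⟨s, hs⟩ := h'
  have h1 := knowledge_of_output A w ht (le_max_left t s)
  have h2 := knowledge_of_output A w hs (le_max_right t s)
  rw [← h1] at ht
  rw [← h2] at hs
  exact Action.output.inj (ht.symm.trans hs)

lemma length_knowledge_mono (A : Algorithm n) (w : Input n) {s t : ℕ} (h : s ≤ t) (i : Fin n)
    (c : Fin 2) : (knowledge A w s i c).length ≤ (knowledge A w t i c).length := by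
  induction t, h using Nat.le_induction with
  | base => rfl
  | succ t _ ih =>
    cases hA : A (knowledge A w t) with
    | output χ => rw [knowledge_succ_of_output A w t hA]; exact ih
    | read j d => rw [length_knowledge_succ A w t hA]; omega

/-- Two inputs that agree with what `A` knows after `t` steps give the same run up to step `t`. -/
lemma knowledge_congr (A : Algorithm n) {w w' : Input n} {t : ℕ}
    (h : ∀ i c, streamPrefix (w' i c) (knowledge A w t i c).length = knowledge A w t i c) :
    ∀ s ≤ t, knowledge A w' s = knowledge A w s := by
  intro s hs
  induction s with
  | zero => rfl
  | succ s ih =>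
    have ih' := ih (by omega)
    cases hA : A (knowledge A w s) with
    | output χ =>
      rw [knowledge_succ_of_output A w s hA, knowledge_succ_of_output A w' s (ih' ▸ hA), ih']
    | read j d =>
      funext i c
      have hlen : (knowledge A w' (s + 1) i c).length = (knowledge A w (s + 1) i c).length := by
        rw [length_knowledge_succ A w s hA, length_knowledge_succ A w' s (ih' ▸ hA), ih']
      rw [knowledge_eq_streamPrefix A w', knowledge_eq_streamPrefix A w, hlen, streamPrefix_eq_iff]
      have h1 := h i c
      rw [knowledge_eq_streamPrefix A w t, length_streamPrefix, streamPrefix_eq_iff] at h1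
      -- Everything known after `s + 1` steps is still known after `t` steps, and there the two
      -- inputs agree.
      intro k hk
      exact h1 k (hk.trans_le (length_knowledge_mono A w hs i c))

lemma sum_length_le_bitsRead (A : Algorithm n) (w : Input n) (t : ℕ) :
    ((∑ i, ∑ c, (knowledge A w t i c).length : ℕ) : ℝ≥0∞) ≤ bitsRead A w :=
  le_iSup (fun t : ℕ => ((∑ i, ∑ c, (knowledge A w t i c).length : ℕ) : ℝ≥0∞)) t

/-- If the total number of bits read is bounded along the run, the algorithm stops. -/
lemma exists_output_of_bounded (A : Algorithm n) (w : Input n) (B : ℕ)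
    (h : ∀ t, ∑ i, ∑ c, (knowledge A w t i c).length ≤ B) :
    ∃ t χ, A (knowledge A w t) = Action.output χ := by
  by_contra! hno
  -- A run that never stops pays one bit at each step.
  have key : ∀ t, t ≤ ∑ i, ∑ c, (knowledge A w t i c).length := by
    intro t
    induction t with
    | zero => simp
    | succ t ih =>
      cases hA : A (knowledge A w t) with
      | output χ => exact absurd hA (hno t χ)
      | read j d =>
        simp_rw [length_knowledge_succ A w t hA, Finset.sum_add_distrib]
        have : (∑ i : Fin n, ∑ c : Fin 2, if i = j ∧ c = d then 1 else 0) = 1 := by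
          rw [Finset.sum_eq_single j, Finset.sum_eq_single d] <;> simp +contextual
        omega
  exact absurd (key (B + 1)) (by have := h (B + 1); omega)

/-! ### Triples of points close to a common line -/

/-- Twice the signed area of a triangle. -/
def signedArea (a b c : Fin 2 → ℝ) : ℝ :=
  (b 0 - a 0) * (c 1 - a 1) - (b 1 - a 1) * (c 0 - a 0)

lemma orientation_eq_sign (a b c : Fin 2 → ℝ) :
    orientation a b c = SignType.sign (signedArea a b c) := by
  unfold orientation signedArea
  congr 1
  rw [Matrix.det_fin_three]
  simp
  ring

/-- The three points are `ε`-close (in the sup norm) to three points of a common line. -/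
def NearLine (ε : ℝ) (a b c : Fin 2 → ℝ) : Prop :=
  ∃ x v : Fin 2 → ℝ, v ≠ 0 ∧
    (∃ t : ℝ, ∀ i, |a i - (x + t • v) i| ≤ ε) ∧
    (∃ t : ℝ, ∀ i, |b i - (x + t • v) i| ≤ ε) ∧
    (∃ t : ℝ, ∀ i, |c i - (x + t • v) i| ≤ ε)

/-- The value at abscissa `c d` of the affine function through `a` and `b`, where `d` is the
axis of abscissas. -/
noncomputable def interpolate (d : Fin 2) (a b c : Fin 2 → ℝ) : ℝ :=
  a (1 - d) + (c d - a d) / (b d - a d) * (b (1 - d) - a (1 - d))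

/-- Taking as abscissa the axis along which the direction is largest makes the slope at most 1 in
absolute value, so errors of `ε` in both coordinates add up to at most `2 * ε` in ordinate. -/
lemma NearLine.exists_affine {ε : ℝ} {a b c : Fin 2 → ℝ} (h : NearLine ε a b c) :
    ∃ (d : Fin 2) (α β : ℝ), |a (1 - d) - (α * a d + β)| ≤ 2 * ε ∧
      |b (1 - d) - (α * b d + β)| ≤ 2 * ε ∧ |c (1 - d) - (α * c d + β)| ≤ 2 * ε := by
  obtain ⟨x, v, hv, ha, hb, hc⟩ := h
  obtain ⟨d, hd⟩ : ∃ d : Fin 2, |v (1 - d)| ≤ |v d| := by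
    rcases le_total |v 0| |v 1| with h | h
    · exact ⟨1, by simpa using h⟩
    · exact ⟨0, by simpa using h⟩
  have hvd : v d ≠ 0 := by
    intro h0
    apply hv
    have h1 : v (1 - d) = 0 := by simpa [h0] using hd
    funext i
    fin_cases d <;> fin_cases i <;> simp_all
  set α := v (1 - d) / v d with hα
  have hα1 : |α| ≤ 1 := by
    rw [hα, abs_div]
    exact (div_le_one (abs_pos.mpr hvd)).mpr hd
  have key : ∀ p : Fin 2 → ℝ, (∃ t : ℝ, ∀ i, |p i - (x + t • v) i| ≤ ε) →
      |p (1 - d) - (α * p d + (x (1 - d) - α * x d))| ≤ 2 * ε := by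
    rintro p ⟨t, ht⟩
    have h1 := ht (1 - d)
    have h2 := ht d
    simp only [Pi.add_apply, Pi.smul_apply, smul_eq_mul] at h1 h2
    have e : p (1 - d) - (α * p d + (x (1 - d) - α * x d)) =
        (p (1 - d) - (x (1 - d) + t * v (1 - d))) - α * (p d - (x d + t * v d)) := by
      rw [hα]; field_simp; ring
    rw [e]
    refine (abs_sub _ _).trans ?_
    rw [abs_mul]
    nlinarith [abs_nonneg (p d - (x d + t * v d)), abs_nonneg α]
  exact ⟨d, α, _, key a ha, key b hb, key c hc⟩

/-- Since `c` is between `a` and `b` in abscissa, its distance to the interpolated value is its own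
residual minus a convex combination of the other two residuals. Extrapolation would give no such
uniform bound. -/
lemma abs_sub_interpolate_le {ε α β : ℝ} {d : Fin 2} {a b c : Fin 2 → ℝ}
    (ha : |a (1 - d) - (α * a d + β)| ≤ ε) (hb : |b (1 - d) - (α * b d + β)| ≤ ε)
    (hc : |c (1 - d) - (α * c d + β)| ≤ ε)
    (h : (a d ≤ c d ∧ c d ≤ b d) ∨ (b d ≤ c d ∧ c d ≤ a d)) :
    |c (1 - d) - interpolate d a b c| ≤ 2 * ε := by
  unfold interpolate
  set τ := (c d - a d) / (b d - a d) with hτ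
  have h1 : τ * (b d - a d) = c d - a d := by
    -- If `a` and `b` have the same abscissa then so has `c`, and the identity holds although the
    -- quotient is `0` by convention.
    rcases eq_or_ne (b d - a d) 0 with h0 | h0
    · rw [h0, mul_zero]; rcases h with h | h <;> linarith [h.1, h.2]
    · rw [hτ]; field_simp
  have h2 : 0 ≤ τ ∧ τ ≤ 1 := by
    rcases h with h | h
    · exact ⟨div_nonneg (by linarith) (by linarith), div_le_one_of_le₀ (by linarith) (by linarith)⟩
    · exact ⟨div_nonneg_of_nonpos (by linarith) (by linarith),
        div_le_one_of_ge (by linarith) (by linarith)⟩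
  have e : c (1 - d) - (a (1 - d) + τ * (b (1 - d) - a (1 - d))) =
      (c (1 - d) - (α * c d + β)) - ((1 - τ) * (a (1 - d) - (α * a d + β)) +
        τ * (b (1 - d) - (α * b d + β))) := by
    have : α * c d = α * a d + α * (τ * (b d - a d)) := by rw [h1]; ring
    linear_combination this
  rw [e]
  rw [abs_le] at *
  obtain ⟨h20, h21⟩ := h2
  constructor <;> nlinarith [ha.1, ha.2, hb.1, hb.2, hc.1, hc.2]

/-- If three points are close to a common line then one of them is close to the line through the
other two, measured along one of the axes. -/
lemma NearLine.exists_interpolate {ε : ℝ} {a b c : Fin 2 → ℝ} (h : NearLine ε a b c) :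
    ∃ d : Fin 2, |c (1 - d) - interpolate d a b c| ≤ 4 * ε ∨
      |b (1 - d) - interpolate d a c b| ≤ 4 * ε ∨ |a (1 - d) - interpolate d b c a| ≤ 4 * ε := by
  obtain ⟨d, α, β, ha, hb, hc⟩ := h.exists_affine
  refine ⟨d, ?_⟩
  rw [show 4 * ε = 2 * (2 * ε) by ring]
  -- The point to interpolate is the one with the middle abscissa.
  rcases le_total (a d) (b d) with h1 | h1 <;> rcases le_total (b d) (c d) with h2 | h2 <;>
    rcases le_total (a d) (c d) with h3 | h3
  · exact Or.inr (Or.inl (abs_sub_interpolate_le ha hc hb (by tauto)))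
  · exact Or.inr (Or.inl (abs_sub_interpolate_le ha hc hb (by tauto)))
  · exact Or.inl (abs_sub_interpolate_le ha hb hc (by tauto))
  · exact Or.inr (Or.inr (abs_sub_interpolate_le hb hc ha (by tauto)))
  · exact Or.inr (Or.inr (abs_sub_interpolate_le hb hc ha (by tauto)))
  · exact Or.inl (abs_sub_interpolate_le ha hb hc (by tauto))
  · exact Or.inr (Or.inl (abs_sub_interpolate_le ha hc hb (by tauto)))
  · exact Or.inr (Or.inl (abs_sub_interpolate_le ha hc hb (by tauto)))

/-- Subtracting the affine function from the ordinates is a shear, which keeps the area up to the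
sign due to a swap of axes. What remains are residuals of at most `2 * ε` and differences of
abscissas of at most 1. It shows that a triple that is not flat is eventually far from every line,
hence that greedy runs stop. -/
lemma NearLine.abs_signedArea_le {ε : ℝ} {a b c : Fin 2 → ℝ} (h : NearLine ε a b c)
    (ha : ∀ i, a i ∈ Set.Icc 0 1) (hb : ∀ i, b i ∈ Set.Icc 0 1) (hc : ∀ i, c i ∈ Set.Icc 0 1) :
    |signedArea a b c| ≤ 8 * ε := by
  obtain ⟨d, α, β, ha', hb', hc'⟩ := h.exists_affine
  have e : |signedArea a b c| =
      |(b d - a d) * ((c (1 - d) - (α * c d + β)) - (a (1 - d) - (α * a d + β))) -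
      ((b (1 - d) - (α * b d + β)) - (a (1 - d) - (α * a d + β))) * (c d - a d)| := by
    unfold signedArea
    fin_cases d
    · simp; congr 1; ring
    · simp; rw [← abs_neg]; congr 1; ring
  rw [e]
  generalize c (1 - d) - (α * c d + β) = x at *
  generalize b (1 - d) - (α * b d + β) = y at *
  generalize a (1 - d) - (α * a d + β) = z at *
  have h1 : |b d - a d| ≤ 1 := by
    rw [abs_le]; constructor <;> linarith [(ha d).1, (ha d).2, (hb d).1, (hb d).2]
  have h2 : |c d - a d| ≤ 1 := by
    rw [abs_le]; constructor <;> linarith [(ha d).1, (ha d).2, (hc d).1, (hc d).2]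
  refine (abs_sub _ _).trans ?_
  rw [abs_mul, abs_mul]
  have h3 : |x - z| ≤ 4 * ε := (abs_sub _ _).trans (by linarith)
  have h4 : |y - z| ≤ 4 * ε := (abs_sub _ _).trans (by linarith)
  nlinarith [abs_nonneg (x - z), abs_nonneg (y - z), abs_nonneg (b d - a d),
    abs_nonneg (c d - a d)]

/-- A flat triangle lies on a line. -/
lemma exists_line_of_signedArea_eq_zero {a b c : Fin 2 → ℝ} (h : signedArea a b c = 0) :
    ∃ x v : Fin 2 → ℝ, v ≠ 0 ∧ (∃ t : ℝ, x + t • v = a) ∧ (∃ t : ℝ, x + t • v = b) ∧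
      (∃ t : ℝ, x + t • v = c) := by
  unfold signedArea at h
  by_cases hab : b = a
  · by_cases hac : c = a
    · exact ⟨a, 1, one_ne_zero, ⟨0, by simp⟩, ⟨0, by simp [hab]⟩, ⟨0, by simp [hac]⟩⟩
    · exact ⟨a, c - a, sub_ne_zero.mpr hac, ⟨0, by simp⟩, ⟨0, by simp [hab]⟩, ⟨1, by simp⟩⟩
  · refine ⟨a, b - a, sub_ne_zero.mpr hab, ⟨0, by simp⟩, ⟨1, by simp⟩, ?_⟩
    by_cases h0 : b 0 - a 0 = 0
    · have h1 : b 1 - a 1 ≠ 0 := by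
        intro h1
        apply hab
        funext i
        fin_cases i
        · simpa using sub_eq_zero.mp h0
        · simpa using sub_eq_zero.mp h1
      have h2 : c 0 - a 0 = 0 := by
        rw [h0] at h
        simpa [h1] using h
      refine ⟨(c 1 - a 1) / (b 1 - a 1), ?_⟩
      funext i
      fin_cases i
      · simp [h0]; linarith
      · simp; field_simp; ring
    · refine ⟨(c 0 - a 0) / (b 0 - a 0), ?_⟩
      funext i
      fin_cases i
      · simp; field_simp; ring
      · simp; field_simp; linarith

lemma NearLine.of_signedArea_eq_zero {a b c : Fin 2 → ℝ} (h : signedArea a b c = 0) {ε : ℝ}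
    (hε : 0 ≤ ε) : NearLine ε a b c := by
  obtain ⟨x, v, hv, ⟨t, rfl⟩, ⟨s, rfl⟩, ⟨u, rfl⟩⟩ := exists_line_of_signedArea_eq_zero h
  exact ⟨x, v, hv, ⟨t, by simpa⟩, ⟨s, by simpa⟩, ⟨u, by simpa⟩⟩

/-! ### Unresolved triples and runs of the greedy method -/

lemma points_mem_Icc (w : Input n) (i : Fin n) (c : Fin 2) : w.points i c ∈ Set.Icc (0 : ℝ) 1 :=
  ⟨Real.ofDigits_nonneg _, Real.ofDigits_le_one _⟩

lemma points_mem_knownCell (A : Algorithm n) (w : Input n) (t : ℕ) (i : Fin n) :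
    w.points i ∈ knownCell (knowledge A w t) i := by
  intro c
  have := ofDigits_mem_prefix (w i c) (knowledge A w t i c).length
  rwa [← knowledge_eq_streamPrefix] at this

/-- As `a` is the coarsest of the three, its resolution bounds the sides of all three cells, hence
the distances between the points and the places where the line meets their cells. This is why the
method refines a point with the fewest known bits. -/
lemma Unresolved.nearLine {K : Knowledge n} (hK : Balanced K) {a b c : Fin n}
    (h : Unresolved K a b c) (hab : (K a 0).length ≤ (K b 0).length)
    (hac : (K a 0).length ≤ (K c 0).length) {P : Fin n → Fin 2 → ℝ}
    (hP : ∀ i, P i ∈ knownCell K i) : NearLine ((1 / 2) ^ (K a 0).length) (P a) (P b) (P c) := by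
  obtain ⟨-, -, -, x, v, hv, ⟨t, ht⟩, ⟨s, hs⟩, ⟨u, hu⟩⟩ := h
  have key : ∀ j, (K a 0).length ≤ (K j 0).length → ∀ q ∈ knownCell K j, ∀ i,
      |P j i - q i| ≤ (1 / 2 : ℝ) ^ (K a 0).length := by
    intro j hj q hq i
    have h1 := hP j i
    have h2 := hq i
    have h3 : (K j i).length = (K j 0).length := by
      fin_cases i
      · rfl
      · exact (hK j).symm
    have h4 : (1 / 2 : ℝ) ^ (K j i).length ≤ (1 / 2 : ℝ) ^ (K a 0).length :=
      pow_le_pow_of_le_one (by norm_num) (by norm_num) (by omega)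
    rw [abs_le]
    constructor <;> linarith [h1.1, h1.2, h2.1, h2.2]
  exact ⟨x, v, hv, ⟨t, key a le_rfl _ ht⟩, ⟨s, key b hab _ hs⟩, ⟨u, key c hac _ hu⟩⟩

/-- Some pair of other points is close, together with the point `i`, to a common line. -/
def NearLineAt (ε : ℝ) (P : Fin n → Fin 2 → ℝ) (i : Fin n) : Prop :=
  ∃ b c, i ≠ b ∧ b ≠ c ∧ i ≠ c ∧ NearLine ε (P i) (P b) (P c)

/-- The states reached by a greedy algorithm are balanced, except while a point is being read. -/
def AlmostBalanced (K : Knowledge n) : Prop :=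
  Balanced K ∨ ∃ i, (K i 0).length = (K i 1).length + 1 ∧
    ∀ j, j ≠ i → (K j 0).length = (K j 1).length

/-- A bit of rank `r` of the first coordinate is read only while exactly `r` bits are known and the
point is the coarsest of an unresolved triple, so each rank that has been read certifies a nearly
flat triple at scale `2^(-r)`. -/
lemma IsGreedy.invariant {A : Algorithm n} (hA : IsGreedy A) (w : Input n) (t : ℕ) :
    AlmostBalanced (knowledge A w t) ∧ ∀ i, ∀ r < (knowledge A w t i 0).length,
      NearLineAt ((1 / 2) ^ r) w.points i := by
  induction t with
  | zero => exact ⟨Or.inl fun i => rfl, fun i r hr => by simp [knowledge] at hr⟩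
  | succ t ih =>
    obtain ⟨hb | ⟨i, hi, hj⟩, hr⟩ := ih
    · by_cases hu : ∃ a b c, Unresolved (knowledge A w t) a b c
      · obtain ⟨a, b, c, hu, hab, hac, hread⟩ := hA.select _ hb hu
        have hlen := length_knowledge_succ A w t hread
        refine ⟨Or.inr ⟨a, ?_, fun j hj => ?_⟩, fun i r hri => ?_⟩
        · simp [hlen, hb a]
        · simp [hlen, hb j, hj]
        · by_cases hlt : r < (knowledge A w t i 0).length
          · exact hr i r hlt
          · rw [hlen] at hri
            have hia : i = a := by
              by_contra hne
              simp [hne] at hri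
              exact hlt hri
            subst hia
            -- The only new rank is that of the bit just read.
            have : r = (knowledge A w t i 0).length := by
              split_ifs at hri <;> omega
            rw [this]
            exact ⟨b, c, hu.1, hu.2.1, hu.2.2.1,
              hu.nearLine hb hab hac (points_mem_knownCell A w t)⟩
      · obtain ⟨χ, hχ, -⟩ := hA.finish _ hb hu
        rw [knowledge_succ_of_output A w t hχ]
        exact ⟨Or.inl hb, hr⟩
    · have hread := hA.second _ i hi hj
      have hlen := length_knowledge_succ A w t hread
      refine ⟨Or.inl fun j => ?_, fun j r hri => ?_⟩
      · rw [hlen, hlen]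
        by_cases hji : j = i
        · subst hji; simp [hi]
        · simp [hji, hj j hji]
      · rw [hlen] at hri
        exact hr j r (by simpa using hri)

lemma AlmostBalanced.length_le {K : Knowledge n} (hK : AlmostBalanced K) (i : Fin n) (c : Fin 2) :
    (K i c).length ≤ (K i 0).length := by
  fin_cases c
  · exact le_rfl
  · obtain hK | ⟨j, hj, hk⟩ := hK
    · exact (hK i).ge
    · by_cases hij : i = j
      · subst hij; exact (Nat.le_succ _).trans hj.ge
      · exact (hk i hij).ge

/-- The second coordinate of a point is never ahead of the first, hence the factor 2; the ranks read
in the first are among those counted by the series. -/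
lemma IsGreedy.bitsRead_le {A : Algorithm n} (hA : IsGreedy A) (w : Input n) :
    bitsRead A w ≤ ∑ i, 2 * ∑' r : ℕ,
      Set.indicator {r : ℕ | NearLineAt ((1 / 2) ^ r) w.points i} (fun _ => (1 : ℝ≥0∞)) r := by
  refine iSup_le fun t => ?_
  obtain ⟨hb, hr⟩ := hA.invariant w t
  push_cast
  refine Finset.sum_le_sum fun i _ => ?_
  have h0 : ((knowledge A w t i 0).length : ℝ≥0∞) ≤ ∑' r : ℕ,
      Set.indicator {r : ℕ | NearLineAt ((1 / 2) ^ r) w.points i} (fun _ => (1 : ℝ≥0∞)) r := by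
    refine le_trans (le_of_eq ?_) (ENNReal.sum_le_tsum (Finset.range (knowledge A w t i 0).length))
    rw [Finset.sum_congr rfl fun r hr' =>
      Set.indicator_of_mem (show r ∈ {r : ℕ | NearLineAt ((1 / 2) ^ r) w.points i} from
        hr i r (Finset.mem_range.mp hr')) _]
    simp
  calc ∑ c, ((knowledge A w t i c).length : ℝ≥0∞)
      ≤ ∑ c : Fin 2, ((knowledge A w t i 0).length : ℝ≥0∞) :=
        Finset.sum_le_sum fun c _ => by exact_mod_cast hb.length_le i c
    _ = 2 * ((knowledge A w t i 0).length : ℝ≥0∞) := by simp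
    _ ≤ _ := by gcongr

/-- The finitely many areas are bounded away from 0, so no triple is nearly flat at a fine scale
`2^(-R)`, no coordinate is read beyond `R` bits, and the run stops. -/
lemma IsGreedy.outputs_of_inGeneralPosition {A : Algorithm n} (hA : IsGreedy A) (w : Input n)
    (hw : InGeneralPosition w.points) : Outputs A w (chirotope w.points) := by
  have hpos : ∀ i b c : Fin n, i ≠ b → b ≠ c → i ≠ c →
      0 < |signedArea (w.points i) (w.points b) (w.points c)| := by
    intro i b c h1 h2 h3
    have := hw i b c h1 h2 h3
    rw [chirotope, orientation_eq_sign] at this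
    exact abs_pos.mpr (sign_ne_zero.mp this)
  obtain ⟨R, hR⟩ : ∃ R : ℕ, ∀ r ≥ R, ∀ i, ¬ NearLineAt ((1 / 2) ^ r) w.points i := by
    have h1 : ∀ x : Fin n × Fin n × Fin n, ∀ᶠ r : ℕ in Filter.atTop,
        x.1 ≠ x.2.1 → x.2.1 ≠ x.2.2 → x.1 ≠ x.2.2 →
        8 * (1 / 2 : ℝ) ^ r < |signedArea (w.points x.1) (w.points x.2.1) (w.points x.2.2)| := by
      rintro ⟨i, b, c⟩
      by_cases h : i ≠ b ∧ b ≠ c ∧ i ≠ c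
      · have ht : Filter.Tendsto (fun r : ℕ => 8 * (1 / 2 : ℝ) ^ r) Filter.atTop (nhds 0) := by
          simpa using (tendsto_pow_atTop_nhds_zero_of_lt_one (r := (1 / 2 : ℝ))
            (by norm_num) (by norm_num)).const_mul 8
        filter_upwards [ht.eventually_lt_const (hpos i b c h.1 h.2.1 h.2.2)] with r hr _ _ _
        exact hr
      · exact Filter.Eventually.of_forall fun r h1 h2 h3 => absurd ⟨h1, h2, h3⟩ h
    obtain ⟨R, hR⟩ := Filter.eventually_atTop.mp (Filter.eventually_all.mpr h1)
    refine ⟨R, fun r hr i => ?_⟩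
    rintro ⟨b, c, h1, h2, h3, h4⟩
    exact absurd (h4.abs_signedArea_le (points_mem_Icc w i) (points_mem_Icc w b)
      (points_mem_Icc w c)) (not_le.mpr (hR r hr (i, b, c) h1 h2 h3))
  have hlen : ∀ t i c, (knowledge A w t i c).length ≤ R := by
    intro t i c
    obtain ⟨hb, hr⟩ := hA.invariant w t
    refine (hb.length_le i c).trans (not_lt.mp fun hlt => ?_)
    exact hR R le_rfl i (hr i R hlt)
  obtain ⟨t, χ, ht⟩ := exists_output_of_bounded A w (∑ _i : Fin n, ∑ _c : Fin 2, R)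
    fun t => Finset.sum_le_sum fun i _ => Finset.sum_le_sum fun c _ => hlen t i c
  refine ⟨t, ?_⟩
  -- In the other two kinds of reachable states a greedy algorithm reads a bit, so it can have
  -- stopped only with everything resolved.
  obtain ⟨hb | ⟨i, hi, hj⟩, -⟩ := hA.invariant w t
  · by_cases hu : ∃ a b c, Unresolved (knowledge A w t) a b c
    · obtain ⟨a, b, c, -, -, -, hread⟩ := hA.select _ hb hu
      rw [ht] at hread
      cases hread
    · obtain ⟨χ', hχ', hall⟩ := hA.finish _ hb hu
      rw [hχ', hall _ (points_mem_knownCell A w t)]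
  · have hread := hA.second _ i hi hj
    rw [ht] at hread
    cases hread

/-! ### Integration over one coordinate of a uniform sample -/

lemma uniformSquare_eq_pi :
    uniformSquare = Measure.pi fun _ : Fin 2 => (volume : Measure ℝ).restrict (Set.Icc 0 1) := by
  unfold uniformSquare
  rw [volume_pi, ← Measure.restrict_pi_pi, Set.pi_univ_Icc]
  rfl

instance : IsProbabilityMeasure ((volume : Measure ℝ).restrict (Set.Icc 0 1)) := ⟨by simp⟩

instance : IsProbabilityMeasure uniformSquare := by
  rw [uniformSquare_eq_pi]; infer_instance

instance : IsProbabilityMeasure (uniformSample n) := by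
  unfold uniformSample; infer_instance

lemma uniformSample_eq_restrict : uniformSample n =
    (volume : Measure (Fin n → Fin 2 → ℝ)).restrict (Set.univ.pi fun _ => Set.Icc 0 1) := by
  unfold uniformSample uniformSquare
  rw [volume_pi, ← Measure.restrict_pi_pi]
  rfl

/-- Almost every sample lies in the unit square. -/
lemma ae_mem_Icc : ∀ᵐ P ∂(uniformSample n), ∀ i c, P i c ∈ Set.Icc (0 : ℝ) 1 := by
  rw [uniformSample_eq_restrict]
  filter_upwards [ae_restrict_mem (MeasurableSet.univ_pi fun _ => measurableSet_Icc)] with P hP i c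
  have := hP i (Set.mem_univ i)
  exact ⟨this.1 c, this.2 c⟩

/-- Replace coordinate `d` of the point `c`. -/
def setCoord (P : Fin n → Fin 2 → ℝ) (c : Fin n) (d : Fin 2) (z : ℝ) : Fin n → Fin 2 → ℝ :=
  Function.update P c (Function.update (P c) d z)

@[simp] lemma setCoord_self (P : Fin n → Fin 2 → ℝ) (c : Fin n) (d : Fin 2) (z : ℝ) :
    setCoord P c d z c d = z := by simp [setCoord]

lemma setCoord_of_ne (P : Fin n → Fin 2 → ℝ) {c a : Fin n} (d : Fin 2) (z : ℝ) (h : a ≠ c) :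
    setCoord P c d z a = P a := by simp [setCoord, h]

lemma setCoord_of_ne_axis (P : Fin n → Fin 2 → ℝ) (c : Fin n) {d e : Fin 2} (z : ℝ) (h : e ≠ d) :
    setCoord P c d z c e = P c e := by simp [setCoord, h]

lemma one_sub_ne_self (d : Fin 2) : 1 - d ≠ d := by fin_cases d <;> decide

@[fun_prop]
lemma measurable_setCoord (P : Fin n → Fin 2 → ℝ) (c : Fin n) (d : Fin 2) :
    Measurable (setCoord P c d) :=
  (measurable_update P).comp (measurable_update (P c))

/-- Comparison of two integrals by integrating out a single coordinate. -/
lemma lintegral_le_of_coord (c : Fin n) (d : Fin 2) {f g : (Fin n → Fin 2 → ℝ) → ℝ≥0∞}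
    (hf : Measurable f) (hg : Measurable g)
    (h : ∀ P, ∫⁻ z in Set.Icc 0 1, f (setCoord P c d z) ≤
      ∫⁻ z in Set.Icc 0 1, g (setCoord P c d z)) :
    ∫⁻ P, f P ∂(uniformSample n) ≤ ∫⁻ P, g P ∂(uniformSample n) := by
  unfold uniformSample
  refine lintegral_le_of_lmarginal_le (μ := fun _ : Fin n => uniformSquare) {c} hf hg ?_
  rw [lmarginal_singleton, lmarginal_singleton]
  intro P
  simp only
  rw [uniformSquare_eq_pi]
  refine lintegral_le_of_lmarginal_le
    (μ := fun _ : Fin 2 => (volume : Measure ℝ).restrict (Set.Icc 0 1)) {d}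
    (hf.comp (measurable_update P)) (hg.comp (measurable_update P)) ?_
  rw [lmarginal_singleton, lmarginal_singleton]
  intro q
  have := h (Function.update P c q)
  simpa [setCoord] using this

/-- Fubini: conditionally on the other `2n - 1` coordinates, the probability is at most the length
of a one-dimensional section. -/
lemma measure_le_of_coord (c : Fin n) (d : Fin 2) {S : Set (Fin n → Fin 2 → ℝ)}
    (hS : MeasurableSet S) {B : ℝ≥0∞} (h : ∀ P, volume {z | setCoord P c d z ∈ S} ≤ B) :
    uniformSample n S ≤ B := by
  have := lintegral_le_of_coord c d (f := S.indicator 1) (g := fun _ => B)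
    (measurable_one.indicator hS) measurable_const ?_
  · rwa [lintegral_indicator_one hS, lintegral_const, measure_univ, mul_one] at this
  · intro P
    have e : ∫⁻ z in Set.Icc 0 1, S.indicator (1 : (Fin n → Fin 2 → ℝ) → ℝ≥0∞) (setCoord P c d z) =
        ∫⁻ z in Set.Icc 0 1, (setCoord P c d ⁻¹' S).indicator 1 z := rfl
    rw [e, lintegral_indicator_one (measurable_setCoord P c d hS)]
    rw [lintegral_const, measure_univ, mul_one]
    exact (Measure.restrict_apply_le _ _).trans (h P)

/-! ### The average cost of the greedy method -/

lemma measurable_eval_eval (a : Fin n) (d : Fin 2) :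
    Measurable fun P : Fin n → Fin 2 → ℝ => P a d :=
  (measurable_pi_apply d).comp (measurable_pi_apply a)

lemma measurable_interpolate (d : Fin 2) (a b c : Fin n) :
    Measurable fun P : Fin n → Fin 2 → ℝ => interpolate d (P a) (P b) (P c) := by
  unfold interpolate
  have h := fun a d => measurable_eval_eval (n := n) a d
  exact (h a _).add ((((h c _).sub (h a _)).div ((h b _).sub (h a _))).mul ((h b _).sub (h a _)))

/-- Samples whose point `c` is `δ`-close to the line through the points `a` and `b`, measured
along the axis `1 - d`. -/
def nearInterpolant (δ : ℝ) (d : Fin 2) (a b c : Fin n) : Set (Fin n → Fin 2 → ℝ) :=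
  {P | |P c (1 - d) - interpolate d (P a) (P b) (P c)| ≤ δ}

lemma measurableSet_nearInterpolant (δ : ℝ) (d : Fin 2) (a b c : Fin n) :
    MeasurableSet (nearInterpolant δ d a b c) :=
  measurableSet_le ((measurable_eval_eval c _).sub (measurable_interpolate d a b c)).abs
    measurable_const

/-- The interpolated value depends on `c` only through its abscissa, so when all else is fixed the
ordinate of `c` is confined to an interval of length `2 * δ`. -/
lemma measure_nearInterpolant_le (δ : ℝ) (d : Fin 2) {a b c : Fin n} (hac : a ≠ c) (hbc : b ≠ c) :
    uniformSample n (nearInterpolant δ d a b c) ≤ ENNReal.ofReal (2 * δ) := by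
  refine measure_le_of_coord c (1 - d) (measurableSet_nearInterpolant δ d a b c) fun P => ?_
  have hsub : {z | setCoord P c (1 - d) z ∈ nearInterpolant δ d a b c} ⊆
      Set.Icc (interpolate d (P a) (P b) (P c) - δ) (interpolate d (P a) (P b) (P c) + δ) := by
    intro z hz
    simp only [nearInterpolant, Set.mem_ofPred_eq, setCoord_self] at hz
    rw [interpolate, setCoord_of_ne P _ z hac, setCoord_of_ne P _ z hbc,
      setCoord_of_ne_axis P c z (one_sub_ne_self d).symm, abs_le] at hz
    rw [interpolate]
    exact ⟨by linarith [hz.1], by linarith [hz.2]⟩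
  refine (measure_mono hsub).trans ?_
  rw [Real.volume_Icc]
  exact ENNReal.ofReal_le_ofReal (by linarith)

/-- Some triple of points containing `i` has a point close to the line through the others. -/
def nearLineEvent (ε : ℝ) (i : Fin n) : Set (Fin n → Fin 2 → ℝ) :=
  ⋃ (b : Fin n) (c : Fin n) (_ : i ≠ b ∧ b ≠ c ∧ i ≠ c) (d : Fin 2),
    (nearInterpolant (4 * ε) d i b c ∪ nearInterpolant (4 * ε) d i c b) ∪
      nearInterpolant (4 * ε) d b c i

lemma measurableSet_nearLineEvent (ε : ℝ) (i : Fin n) : MeasurableSet (nearLineEvent ε i) := by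
  refine MeasurableSet.iUnion fun b => MeasurableSet.iUnion fun c => MeasurableSet.iUnion fun _ =>
    MeasurableSet.iUnion fun d => ?_
  exact ((measurableSet_nearInterpolant _ _ _ _ _).union
    (measurableSet_nearInterpolant _ _ _ _ _)).union (measurableSet_nearInterpolant _ _ _ _ _)

/-- The event `nearLineEvent` is a majorant whose measurability and probability are easy, unlike the
existence of a line. -/
lemma NearLineAt.mem_nearLineEvent {ε : ℝ} {P : Fin n → Fin 2 → ℝ} {i : Fin n}
    (h : NearLineAt ε P i) : P ∈ nearLineEvent ε i := by
  obtain ⟨b, c, h1, h2, h3, h4⟩ := h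
  obtain ⟨d, h5⟩ := h4.exists_interpolate
  simp only [nearLineEvent, Set.mem_iUnion]
  refine ⟨b, c, ⟨h1, h2, h3⟩, d, ?_⟩
  simp only [nearInterpolant, Set.mem_union, Set.mem_ofPred_eq]
  tauto

/-- The constant is 2 axes times 3 choices of the interpolated point times the width `8 * ε`; there
are at most `n ^ 2` choices of the other two points. -/
lemma measure_nearLineEvent_le {ε : ℝ} (hε : 0 ≤ ε) (i : Fin n) :
    uniformSample n (nearLineEvent ε i) ≤ ENNReal.ofReal (48 * n ^ 2 * ε) := by
  have h1 : ∀ b c : Fin n, uniformSample n (⋃ (_ : i ≠ b ∧ b ≠ c ∧ i ≠ c) (d : Fin 2),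
      (nearInterpolant (4 * ε) d i b c ∪ nearInterpolant (4 * ε) d i c b) ∪
      nearInterpolant (4 * ε) d b c i) ≤ ENNReal.ofReal (48 * ε) := by
    intro b c
    by_cases h : i ≠ b ∧ b ≠ c ∧ i ≠ c
    · simp only [h, ne_eq, not_false_eq_true, and_self, Set.iUnion_true]
      refine (measure_iUnion_fintype_le _ _).trans ?_
      have h2 : ∀ d : Fin 2, uniformSample n
          ((nearInterpolant (4 * ε) d i b c ∪ nearInterpolant (4 * ε) d i c b) ∪
          nearInterpolant (4 * ε) d b c i) ≤ ENNReal.ofReal (24 * ε) := by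
        intro d
        refine (measure_union_le _ _).trans
          ((add_le_add_left (measure_union_le _ _) _).trans ?_)
        refine (add_le_add (add_le_add (measure_nearInterpolant_le _ d h.2.2 h.2.1)
          (measure_nearInterpolant_le _ d h.1 h.2.1.symm))
          (measure_nearInterpolant_le _ d h.1.symm h.2.2.symm)).trans ?_
        rw [← ENNReal.ofReal_add (by positivity) (by positivity),
          ← ENNReal.ofReal_add (by positivity) (by positivity)]
        exact ENNReal.ofReal_le_ofReal (by linarith)
      refine (Finset.sum_le_sum fun d _ => h2 d).trans ?_
      rw [Fin.sum_univ_two, ← ENNReal.ofReal_add (by positivity) (by positivity)]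
      exact ENNReal.ofReal_le_ofReal (by linarith)
    · simp only [h, Set.iUnion_of_empty, measure_empty, zero_le]
  refine (measure_iUnion_fintype_le _ _).trans ?_
  refine (Finset.sum_le_sum fun b _ => (measure_iUnion_fintype_le _ _).trans
    (Finset.sum_le_sum fun c _ => h1 b c)).trans ?_
  simp only [Finset.sum_const, Finset.card_univ, Fintype.card_fin, nsmul_eq_mul]
  rw [← ENNReal.ofReal_natCast, ← ENNReal.ofReal_mul (by positivity),
    ← ENNReal.ofReal_mul (by positivity)]
  exact ENNReal.ofReal_le_ofReal (by ring_nf; rfl)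

/-- Almost every sample is in general position. -/
lemma ae_inGeneralPosition : ∀ᵐ P ∂(uniformSample n), InGeneralPosition P := by
  -- A flat triple is near a line with `ε = 0`, where the union bound is 0.
  have h0 : ∀ i : Fin n, ∀ᵐ P ∂(uniformSample n), P ∉ nearLineEvent 0 i := by
    intro i
    have := measure_nearLineEvent_le (le_refl (0 : ℝ)) i
    rw [mul_zero, ENNReal.ofReal_zero, nonpos_iff_eq_zero] at this
    exact measure_eq_zero_iff_ae_notMem.mp this
  filter_upwards [ae_all_iff.mpr h0] with P hP i j k hij hjk hik h
  refine hP i (NearLineAt.mem_nearLineEvent ⟨j, k, hij, hjk, hik, ?_⟩)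
  rw [chirotope, orientation_eq_sign, sign_eq_zero_iff] at h
  exact NearLine.of_signedArea_eq_zero h le_rfl

/-- By convexity the graph is below its chord on `[0, 1]` (Bernoulli). -/
lemma half_rpow_le {δ : ℝ} (h0 : 0 ≤ δ) (h1 : δ ≤ 1) : (1 / 2 : ℝ) ^ δ ≤ 1 - δ / 2 := by
  have := _root_.rpow_one_add_le_one_add_mul_self (s := -1 / 2) (by norm_num) h0 h1
  norm_num at this ⊢
  linarith

/-- The sum of a geometric series of ratio `1/2` truncated at `1`. -/
lemma tsum_min_one_geometric_le {M : ℝ} (hM : 1 ≤ M) :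
    ∑' r : ℕ, min 1 (ENNReal.ofReal (M * (1 / 2) ^ r)) ≤ ENNReal.ofReal (Real.logb 2 M + 2) := by
  set L := Real.logb 2 M with hL
  have hL0 : 0 ≤ L := Real.logb_nonneg (by norm_num) hM
  have hML : M = 2 ^ L := by rw [hL, Real.rpow_logb] <;> linarith
  -- The `k` first terms are bounded by 1 and the others by a geometric series of sum at most `2 -
  -- (k - L)`. The rounding error `k - L` cancels in the total.
  set k := ⌈L⌉₊ with hk
  have hk1 : L ≤ k := Nat.le_ceil L
  have hk2 : (k : ℝ) < L + 1 := Nat.ceil_lt_add_one hL0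
  have hMk : M * (1 / 2) ^ k ≤ 1 - (k - L) / 2 := by
    have : M * (1 / 2) ^ k = (1 / 2 : ℝ) ^ ((k : ℝ) - L) := by
      rw [hML, Real.rpow_sub (by norm_num), Real.rpow_natCast, one_div, Real.inv_rpow (by norm_num)]
      field_simp
    rw [this]
    exact half_rpow_le (by linarith) (by linarith)
  rw [← Summable.sum_add_tsum_nat_add' (k := k) ENNReal.summable]
  have h1 : ∑ r ∈ Finset.range k, min 1 (ENNReal.ofReal (M * (1 / 2) ^ r)) ≤
      ENNReal.ofReal k := by
    refine (Finset.sum_le_sum fun r _ => min_le_left _ _).trans ?_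
    simp
  have h2 : ∑' r : ℕ, min 1 (ENNReal.ofReal (M * (1 / 2) ^ (r + k))) ≤
      ENNReal.ofReal (2 - (k - L)) := by
    have h3 : ∀ r : ℕ, min 1 (ENNReal.ofReal (M * (1 / 2) ^ (r + k))) ≤
        ENNReal.ofReal (1 - (k - L) / 2) * ENNReal.ofReal (1 / 2) ^ r := by
      intro r
      refine (min_le_right _ _).trans ?_
      rw [← ENNReal.ofReal_pow (by norm_num), ← ENNReal.ofReal_mul (by linarith)]
      refine ENNReal.ofReal_le_ofReal ?_
      rw [pow_add]
      have : (0 : ℝ) < (1 / 2) ^ r := by positivity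
      nlinarith
    refine (ENNReal.tsum_le_tsum h3).trans ?_
    rw [ENNReal.tsum_mul_left, ENNReal.tsum_geometric]
    have : (1 - ENNReal.ofReal (1 / 2))⁻¹ = ENNReal.ofReal 2 := by
      rw [← ENNReal.ofReal_one, ← ENNReal.ofReal_sub _ (by norm_num),
        ← ENNReal.ofReal_inv_of_pos (by norm_num)]
      norm_num
    rw [this, ← ENNReal.ofReal_mul (by linarith)]
    exact ENNReal.ofReal_le_ofReal (by linarith)
  refine (add_le_add h1 h2).trans ?_
  rw [← ENNReal.ofReal_add (by positivity) (by linarith)]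
  exact ENNReal.ofReal_le_ofReal (by linarith)

lemma points_inputOf {P : Fin n → Fin 2 → ℝ} (hP : ∀ i c, P i c ∈ Set.Icc (0 : ℝ) 1) :
    (inputOf P).points = P := by
  funext i c
  exact ofDigits_bits (hP i c)

theorem IsGreedy.determinesChirotope {A : Algorithm n} (hA : IsGreedy A) :
    DeterminesChirotope A := by
  unfold DeterminesChirotope
  filter_upwards [ae_mem_Icc, ae_inGeneralPosition] with P hP hgp
  have := hA.outputs_of_inGeneralPosition (inputOf P) (by rwa [points_inputOf hP])
  rwa [points_inputOf hP] at this

theorem IsGreedy.averageBits_le {A : Algorithm n} (hA : IsGreedy A) :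
    averageBits A ≤ ENNReal.ofReal (4 * n * Real.logb 2 n + 16 * n) := by
  rcases Nat.eq_zero_or_pos n with rfl | hn
  · have : ∀ P, bitsRead A (inputOf P) = 0 := fun P => by simp [bitsRead]
    simp [averageBits, this]
  have hn1 : (1 : ℝ) ≤ n := by exact_mod_cast hn
  have h1 : averageBits A ≤ ∫⁻ P, ∑ i, 2 * ∑' r : ℕ,
      (nearLineEvent ((1 / 2) ^ r) i).indicator (1 : (Fin n → Fin 2 → ℝ) → ℝ≥0∞) P
        ∂(uniformSample n) := by
    refine lintegral_mono_ae ?_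
    filter_upwards [ae_mem_Icc] with P hP
    refine (hA.bitsRead_le (inputOf P)).trans ?_
    rw [points_inputOf hP]
    refine Finset.sum_le_sum fun i _ => ?_
    gcongr with r
    by_cases hr : NearLineAt ((1 / 2) ^ r) P i
    · rw [Set.indicator_of_mem hr.mem_nearLineEvent, Pi.one_apply]
      exact Set.indicator_apply_le fun _ => le_rfl
    · refine (le_of_eq ?_).trans zero_le
      exact Set.indicator_of_notMem (s := {r : ℕ | NearLineAt ((1 / 2) ^ r) P i}) hr _
  have hmeas : ∀ i : Fin n, ∀ r : ℕ, Measurable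
      ((nearLineEvent ((1 / 2) ^ r) i).indicator (1 : (Fin n → Fin 2 → ℝ) → ℝ≥0∞)) :=
    fun i r => measurable_one.indicator (measurableSet_nearLineEvent _ i)
  refine h1.trans ?_
  rw [lintegral_finsetSum _ fun i _ => (Measurable.tsum (hmeas i)).const_mul _]
  have h2 : ∀ i : Fin n, ∫⁻ P, 2 * ∑' r : ℕ,
      (nearLineEvent ((1 / 2) ^ r) i).indicator (1 : (Fin n → Fin 2 → ℝ) → ℝ≥0∞) P
        ∂(uniformSample n) ≤
      2 * ENNReal.ofReal (2 * Real.logb 2 n + 8) := by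
    intro i
    rw [lintegral_const_mul _ (Measurable.tsum (hmeas i)),
      lintegral_tsum fun r => (hmeas i r).aemeasurable]
    gcongr
    -- Rounding the constant 48 up to `64 = 2 ^ 6` gives `2 log n + 6`, plus 2 from the tail. With 2
    -- coordinates and `n` points this makes `4 n log n + 16 n`.
    have h64 : Real.logb 2 (64 * (n : ℝ) ^ 2) + 2 = 2 * Real.logb 2 n + 8 := by
      rw [Real.logb_mul (by norm_num) (by positivity), Real.logb_pow,
        show (64 : ℝ) = 2 ^ (6 : ℕ) by norm_num, Real.logb_pow, Real.logb_self_eq_one (by norm_num)]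
      push_cast; ring
    rw [← h64]
    refine le_trans ?_ (tsum_min_one_geometric_le (M := 64 * (n : ℝ) ^ 2) (by nlinarith))
    refine ENNReal.tsum_le_tsum fun r => ?_
    rw [lintegral_indicator_one (measurableSet_nearLineEvent _ i)]
    refine le_min prob_le_one ((measure_nearLineEvent_le (by positivity) i).trans ?_)
    refine ENNReal.ofReal_le_ofReal ?_
    have : (0 : ℝ) < (1 / 2) ^ r := by positivity
    gcongr
    norm_num
  refine (Finset.sum_le_sum fun i _ => h2 i).trans ?_
  have hlog : 0 ≤ Real.logb 2 n := Real.logb_nonneg (by norm_num) hn1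
  simp only [Finset.sum_const, Finset.card_univ, Fintype.card_fin, nsmul_eq_mul]
  rw [← ENNReal.ofReal_natCast, show (2 : ℝ≥0∞) = ENNReal.ofReal 2 by simp,
    ← ENNReal.ofReal_mul (by norm_num), ← ENNReal.ofReal_mul (by positivity)]
  exact ENNReal.ofReal_le_ofReal (by linarith)

/-! ### Deciding whether a triple is resolved, by integer arithmetic -/

/-- The list of the pairs of known prefixes. -/
abbrev State : Type := List (List (Fin 2) × List (Fin 2))

/-- The natural number written by a binary string, the most significant bit first. -/
def binaryValue (u : List (Fin 2)) : ℕ := u.foldl (fun (v : ℕ) (b : Fin 2) => 2 * v + b) 0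

/-- The total number of known bits. -/
def State.size (L : State) : ℕ := (L.flatMap fun p => p.1 ++ p.2).length

/-- The known prefix of coordinate `c` (`0` or `1`) of point `j`. -/
def State.coord (L : State) (j : ℕ) (c : ℕ) : List (Fin 2) :=
  if c = 0 then (L.getD j ([], [])).1 else (L.getD j ([], [])).2

/-- Coordinate `c` of a corner of the cell of point `j`, scaled to an integer. The corner is
selected by the parity of `e`. -/
def State.corner (L : State) (j c e : ℕ) : ℕ :=
  (binaryValue (L.coord j c) + e % 2) * 2 ^ (L.size - (L.coord j c).length)

/-- The positive terms of the signed area of a triangle whose vertices are corners of the cells of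
three points, selected by the binary digits of `e`. -/
def State.areaPos (L : State) (a b c e : ℕ) : ℕ :=
  L.corner a 0 e * L.corner b 1 (e / 8) + L.corner b 0 (e / 4) * L.corner c 1 (e / 32) +
    L.corner c 0 (e / 16) * L.corner a 1 (e / 2)

/-- The negative terms of the signed area of a triangle whose vertices are corners of the cells of
three points, selected by the binary digits of `e`. -/
def State.areaNeg (L : State) (a b c e : ℕ) : ℕ :=
  L.corner a 0 e * L.corner c 1 (e / 32) + L.corner b 0 (e / 4) * L.corner a 1 (e / 2) +
    L.corner c 0 (e / 16) * L.corner b 1 (e / 8)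

/-- The signed area of triangles with vertices at the corners of the cells of three distinct
points takes nonnegative and nonpositive values. -/
def State.Ambiguous (L : State) (a b c : ℕ) : Prop :=
  (a ≠ b ∧ b ≠ c ∧ a ≠ c) ∧ (∃ e < 64, L.areaNeg a b c e ≤ L.areaPos a b c e) ∧
    (∃ e < 64, L.areaPos a b c e ≤ L.areaNeg a b c e)

/-- The point `a` is to be read by the greedy method. -/
def State.Selectable (L : State) (a : ℕ) : Prop :=
  ∃ b < L.length, ∃ c < L.length, L.Ambiguous a b c ∧
    (L.coord a 0).length ≤ (L.coord b 0).length ∧ (L.coord a 0).length ≤ (L.coord c 0).length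

/-- One coordinate of the point `a` has just been read. -/
def State.HalfRead (L : State) (a : ℕ) : Prop :=
  (L.coord a 0).length = (L.coord a 1).length + 1

/-- The sign of the signed area of the triangle formed by the lower left corners of the cells. -/
def State.sign (L : State) (a b c : ℕ) : ℤ :=
  if L.areaNeg a b c 0 < L.areaPos a b c 0 then 1
  else if L.areaPos a b c 0 < L.areaNeg a b c 0 then -1 else 0

instance (L : State) (a b c : ℕ) : Decidable (L.Ambiguous a b c) := by
  unfold State.Ambiguous; infer_instance

instance (L : State) : DecidablePred L.Selectable := fun a => by
  unfold State.Selectable; infer_instance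

instance (L : State) : DecidablePred L.HalfRead := fun a => by
  unfold State.HalfRead; infer_instance

/-- The first point of which one coordinate has just been read. -/
def State.half (L : State) : ℕ := (List.range L.length).findIdx fun a => decide (L.HalfRead a)

/-- The first point that is to be read by the greedy method. -/
def State.selected (L : State) : ℕ :=
  (List.range L.length).findIdx fun a => decide (L.Selectable a)

/-- The next action of a greedy algorithm, as a finite piece of data. -/
def State.greedyCode (L : State) : (ℕ × ℕ) ⊕ List (List (List ℤ)) :=
  -- An index search that fails returns the length of the list, so these comparisons test whether a
  -- suitable point exists.
  if L.half < L.length then Sum.inl (L.half, 1)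
  else if L.selected < L.length then Sum.inl (L.selected, 0)
  else Sum.inr ((List.range L.length).map fun i => (List.range L.length).map fun j =>
    (List.range L.length).map fun k => L.sign i j k)

section Primrec

variable {α : Type*} [Primcodable α]

lemma primrecPred_exists_lt {f : α → ℕ} {p : α → ℕ → Prop} (hf : Primrec f)
    (hp : PrimrecPred fun x : α × ℕ => p x.1 x.2) : PrimrecPred fun a => ∃ x < f a, p a x := by
  have h : PrimrecRel fun (x : ℕ) (a : α) => p a x := hp.comp (Primrec.snd.pair Primrec.fst)
  exact (h.exists_mem_list.comp (Primrec.list_range.comp hf) Primrec.id).of_eq (by simp)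

lemma primrec_two_pow : Primrec fun n : ℕ => 2 ^ n := by
  refine (Primrec.nat_rec₁ 1 (f := fun _ m => 2 * m)
    (Primrec.nat_mul.comp (Primrec.const 2) Primrec.snd)).of_eq fun n => ?_
  induction n with
  | zero => rfl
  | succ n ih => rw [pow_succ', ← ih]

lemma primrec_binaryValue : Primrec binaryValue := by
  have h : Primrec₂ fun (_ : List (Fin 2)) (p : ℕ × Fin 2) => 2 * p.1 + (p.2 : ℕ) :=
    Primrec.nat_add.comp (Primrec.nat_mul.comp (Primrec.const 2) (Primrec.fst.comp Primrec.snd))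
      ((Primrec.dom_finite (fun b : Fin 2 => (b : ℕ))).comp (Primrec.snd.comp Primrec.snd))
  exact Primrec.list_foldl Primrec.id (Primrec.const 0) h

lemma primrec_size : Primrec State.size :=
  Primrec.list_length.comp (Primrec.list_flatMap Primrec.id
    (Primrec.list_append.comp (Primrec.fst.comp Primrec.snd) (Primrec.snd.comp Primrec.snd)).to₂)

lemma primrec_coord {L : α → State} {j c : α → ℕ} (hL : Primrec L) (hj : Primrec j)
    (hc : Primrec c) : Primrec fun x => (L x).coord (j x) (c x) := by
  have h := (Primrec.list_getD (([], []) : List (Fin 2) × List (Fin 2))).comp hL hj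
  exact Primrec.ite (Primrec.eq.comp hc (Primrec.const 0)) (Primrec.fst.comp h)
    (Primrec.snd.comp h)

lemma primrec_corner {L : α → State} {j c e : α → ℕ} (hL : Primrec L) (hj : Primrec j)
    (hc : Primrec c) (he : Primrec e) : Primrec fun x => (L x).corner (j x) (c x) (e x) := by
  have h := primrec_coord hL hj hc
  exact Primrec.nat_mul.comp
    (Primrec.nat_add.comp (primrec_binaryValue.comp h) (Primrec.nat_mod.comp he (Primrec.const 2)))
    (primrec_two_pow.comp (Primrec.nat_sub.comp (primrec_size.comp hL)
      (Primrec.list_length.comp h)))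

lemma primrec_areaPos {L : α → State} {a b c e : α → ℕ} (hL : Primrec L) (ha : Primrec a)
    (hb : Primrec b) (hc : Primrec c) (he : Primrec e) :
    Primrec fun x => (L x).areaPos (a x) (b x) (c x) (e x) := by
  have hd : ∀ m : ℕ, Primrec fun x => e x / m := fun m =>
    Primrec.nat_div.comp he (Primrec.const m)
  have h0 := Primrec.const (α := α) 0
  have h1 := Primrec.const (α := α) 1
  exact Primrec.nat_add.comp (Primrec.nat_add.comp
    (Primrec.nat_mul.comp (primrec_corner hL ha h0 he) (primrec_corner hL hb h1 (hd 8)))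
    (Primrec.nat_mul.comp (primrec_corner hL hb h0 (hd 4)) (primrec_corner hL hc h1 (hd 32))))
    (Primrec.nat_mul.comp (primrec_corner hL hc h0 (hd 16)) (primrec_corner hL ha h1 (hd 2)))

lemma primrec_areaNeg {L : α → State} {a b c e : α → ℕ} (hL : Primrec L) (ha : Primrec a)
    (hb : Primrec b) (hc : Primrec c) (he : Primrec e) :
    Primrec fun x => (L x).areaNeg (a x) (b x) (c x) (e x) := by
  have hd : ∀ m : ℕ, Primrec fun x => e x / m := fun m =>
    Primrec.nat_div.comp he (Primrec.const m)
  have h0 := Primrec.const (α := α) 0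
  have h1 := Primrec.const (α := α) 1
  exact Primrec.nat_add.comp (Primrec.nat_add.comp
    (Primrec.nat_mul.comp (primrec_corner hL ha h0 he) (primrec_corner hL hc h1 (hd 32)))
    (Primrec.nat_mul.comp (primrec_corner hL hb h0 (hd 4)) (primrec_corner hL ha h1 (hd 2))))
    (Primrec.nat_mul.comp (primrec_corner hL hc h0 (hd 16)) (primrec_corner hL hb h1 (hd 8)))

lemma primrecPred_ambiguous {L : α → State} {a b c : α → ℕ} (hL : Primrec L) (ha : Primrec a)
    (hb : Primrec b) (hc : Primrec c) :
    PrimrecPred fun x => (L x).Ambiguous (a x) (b x) (c x) := by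
  have hP := primrec_areaPos (hL.comp Primrec.fst) (ha.comp Primrec.fst) (hb.comp Primrec.fst)
    (hc.comp Primrec.fst) (Primrec.snd (α := α) (β := ℕ))
  have hN := primrec_areaNeg (hL.comp Primrec.fst) (ha.comp Primrec.fst) (hb.comp Primrec.fst)
    (hc.comp Primrec.fst) (Primrec.snd (α := α) (β := ℕ))
  refine PrimrecPred.and (PrimrecPred.and (Primrec.eq.comp ha hb).not
    (PrimrecPred.and (Primrec.eq.comp hb hc).not (Primrec.eq.comp ha hc).not))
    (PrimrecPred.and ?_ ?_)
  · exact primrecPred_exists_lt (Primrec.const 64) (Primrec.nat_le.comp hN hP)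
  · exact primrecPred_exists_lt (Primrec.const 64) (Primrec.nat_le.comp hP hN)

lemma primrecPred_selectable : PrimrecPred fun x : State × ℕ => x.1.Selectable x.2 := by
  refine primrecPred_exists_lt (Primrec.list_length.comp Primrec.fst) ?_
  refine primrecPred_exists_lt (Primrec.list_length.comp (Primrec.fst.comp Primrec.fst)) ?_
  have hL : Primrec fun x : ((State × ℕ) × ℕ) × ℕ => x.1.1.1 :=
    Primrec.fst.comp (Primrec.fst.comp Primrec.fst)
  have ha : Primrec fun x : ((State × ℕ) × ℕ) × ℕ => x.1.1.2 :=
    Primrec.snd.comp (Primrec.fst.comp Primrec.fst)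
  have hb : Primrec fun x : ((State × ℕ) × ℕ) × ℕ => x.1.2 := Primrec.snd.comp Primrec.fst
  have hc : Primrec fun x : ((State × ℕ) × ℕ) × ℕ => x.2 := Primrec.snd
  have hlen := fun {j : ((State × ℕ) × ℕ) × ℕ → ℕ} (hj : Primrec j) =>
    Primrec.list_length.comp (primrec_coord hL hj (Primrec.const 0))
  exact PrimrecPred.and (primrecPred_ambiguous hL ha hb hc)
    (PrimrecPred.and (Primrec.nat_le.comp (hlen ha) (hlen hb))
      (Primrec.nat_le.comp (hlen ha) (hlen hc)))

lemma primrecPred_halfRead : PrimrecPred fun x : State × ℕ => x.1.HalfRead x.2 :=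
  Primrec.eq.comp
    (Primrec.list_length.comp (primrec_coord Primrec.fst Primrec.snd (Primrec.const 0)))
    (Primrec.succ.comp
      (Primrec.list_length.comp (primrec_coord Primrec.fst Primrec.snd (Primrec.const 1))))

lemma primrec_half : Primrec State.half :=
  Primrec.list_findIdx (Primrec.list_range.comp Primrec.list_length) primrecPred_halfRead.decide

lemma primrec_selected : Primrec State.selected :=
  Primrec.list_findIdx (Primrec.list_range.comp Primrec.list_length) primrecPred_selectable.decide

lemma primrec_sign {L : α → State} {a b c : α → ℕ} (hL : Primrec L) (ha : Primrec a)
    (hb : Primrec b) (hc : Primrec c) : Primrec fun x => (L x).sign (a x) (b x) (c x) := by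
  have hP := primrec_areaPos hL ha hb hc (Primrec.const 0)
  have hN := primrec_areaNeg hL ha hb hc (Primrec.const 0)
  exact Primrec.ite (Primrec.nat_lt.comp hN hP) (Primrec.const 1)
    (Primrec.ite (Primrec.nat_lt.comp hP hN) (Primrec.const (-1)) (Primrec.const 0))

lemma primrec_greedyCode : Primrec State.greedyCode := by
  have hlen : Primrec fun L : State => L.length := Primrec.list_length
  refine Primrec.ite (Primrec.nat_lt.comp primrec_half hlen)
    (Primrec.sumInl.comp (primrec_half.pair (Primrec.const 1)))
    (Primrec.ite (Primrec.nat_lt.comp primrec_selected hlen)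
      (Primrec.sumInl.comp (primrec_selected.pair (Primrec.const 0))) (Primrec.sumInr.comp ?_))
  have hr : Primrec fun L : State => List.range L.length := Primrec.list_range.comp hlen
  refine Primrec.list_map hr ?_
  refine Primrec.list_map (hr.comp Primrec.fst) ?_
  refine Primrec.list_map (hr.comp (Primrec.fst.comp Primrec.fst)) ?_
  exact primrec_sign (Primrec.fst.comp (Primrec.fst.comp Primrec.fst))
    (Primrec.snd.comp (Primrec.fst.comp Primrec.fst)) (Primrec.snd.comp Primrec.fst) Primrec.snd

end Primrec

/-! ### Geometry of unresolved triples -/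

lemma convex_knownCell (K : Knowledge n) (i : Fin n) : Convex ℝ (knownCell K i) := by
  have : knownCell K i = Set.univ.pi fun c => Set.Icc (prefixValue (K i c))
      (prefixValue (K i c) + (1 / 2 : ℝ) ^ (K i c).length) := by
    ext p; simp only [knownCell, Set.mem_univ_pi]; rfl
  rw [this]
  exact convex_pi fun c _ => convex_Icc _ _

lemma continuous_signedArea : Continuous fun p : (Fin 2 → ℝ) × (Fin 2 → ℝ) × (Fin 2 → ℝ) =>
    signedArea p.1 p.2.1 p.2.2 := by
  unfold signedArea
  fun_prop

/-- The product of the three convex cells is connected, so the intermediate value theorem applies to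
the area. -/
lemma exists_signedArea_eq_zero {K : Knowledge n} {a b c : Fin n} {p p' q q' r r' : Fin 2 → ℝ}
    (hp : p ∈ knownCell K a) (hp' : p' ∈ knownCell K a) (hq : q ∈ knownCell K b)
    (hq' : q' ∈ knownCell K b) (hr : r ∈ knownCell K c) (hr' : r' ∈ knownCell K c)
    (h : signedArea p q r ≤ 0) (h' : 0 ≤ signedArea p' q' r') :
    ∃ x ∈ knownCell K a, ∃ y ∈ knownCell K b, ∃ z ∈ knownCell K c, signedArea x y z = 0 := by
  have hpre : IsPreconnected (knownCell K a ×ˢ knownCell K b ×ˢ knownCell K c) :=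
    ((convex_knownCell K a).prod
      ((convex_knownCell K b).prod (convex_knownCell K c))).isPreconnected
  obtain ⟨⟨x, y, z⟩, ⟨hx, hy, hz⟩, h0⟩ := hpre.intermediate_value (a := (p, q, r))
    (b := (p', q', r')) ⟨hp, hq, hr⟩ ⟨hp', hq', hr'⟩ continuous_signedArea.continuousOn ⟨h, h'⟩
  exact ⟨x, hx, y, hy, z, hz, h0⟩

/-- This replaces the quantification over lines by the vanishing of a polynomial on the cells. -/
lemma unresolved_iff {K : Knowledge n} {a b c : Fin n} : Unresolved K a b c ↔
    (a ≠ b ∧ b ≠ c ∧ a ≠ c) ∧ ∃ p ∈ knownCell K a, ∃ q ∈ knownCell K b, ∃ r ∈ knownCell K c,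
      signedArea p q r = 0 := by
  constructor
  · rintro ⟨h1, h2, h3, x, v, hv, ⟨t, ht⟩, ⟨s, hs⟩, ⟨u, hu⟩⟩
    refine ⟨⟨h1, h2, h3⟩, _, ht, _, hs, _, hu, ?_⟩
    simp only [signedArea, Pi.add_apply, Pi.smul_apply, smul_eq_mul]
    ring
  · rintro ⟨⟨h1, h2, h3⟩, p, hp, q, hq, r, hr, h⟩
    obtain ⟨x, v, hv, ⟨t, rfl⟩, ⟨s, rfl⟩, ⟨u, rfl⟩⟩ := exists_line_of_signedArea_eq_zero h
    exact ⟨h1, h2, h3, x, v, hv, ⟨t, hp⟩, ⟨s, hq⟩, ⟨u, hr⟩⟩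

/-- A corner of a known cell, selected by the parities of `e` and `f`. -/
noncomputable def cellCorner (K : Knowledge n) (i : Fin n) (e f : ℕ) : Fin 2 → ℝ :=
  ![prefixValue (K i 0) + (e % 2 : ℕ) * (1 / 2 : ℝ) ^ (K i 0).length,
    prefixValue (K i 1) + (f % 2 : ℕ) * (1 / 2 : ℝ) ^ (K i 1).length]

lemma cellCorner_mem (K : Knowledge n) (i : Fin n) (e f : ℕ) :
    cellCorner K i e f ∈ knownCell K i := by
  have key : ∀ (l : ℝ) (k e : ℕ), l + (e % 2 : ℕ) * (1 / 2 : ℝ) ^ k ∈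
      Set.Icc l (l + (1 / 2 : ℝ) ^ k) := by
    intro l k e
    have h0 : (0 : ℝ) < (1 / 2) ^ k := by positivity
    have h1 : ((e % 2 : ℕ) : ℝ) ≤ 1 := by exact_mod_cast Nat.le_of_lt_succ (Nat.mod_lt e two_pos)
    have h2 : (0 : ℝ) ≤ ((e % 2 : ℕ) : ℝ) := by positivity
    constructor <;> nlinarith
  intro c
  fin_cases c
  · exact key _ _ e
  · exact key _ _ f

/-- An affine function on an interval is bounded by its value at one of the ends. -/
lemma exists_endpoint_ge {f : ℝ → ℝ} (hf : ∀ z, f z = f 0 + z * (f 1 - f 0)) {l h z : ℝ}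
    (hz : z ∈ Set.Icc l (l + h)) : ∃ e < 2, f z ≤ f (l + (e % 2 : ℕ) * h) := by
  rcases le_total (f 1 - f 0) 0 with h0 | h0
  · refine ⟨0, by norm_num, ?_⟩
    rw [hf z, hf (l + _)]
    norm_num
    nlinarith [hz.1]
  · refine ⟨1, by norm_num, ?_⟩
    rw [hf z, hf (l + _)]
    norm_num
    nlinarith [hz.2]

/-- The signed area, as well as its opposite, is maximal at corners of the cells. -/
lemma exists_corner_ge (s : ℝ) {K : Knowledge n} {a b c : Fin n} {p q r : Fin 2 → ℝ}
    (hp : p ∈ knownCell K a) (hq : q ∈ knownCell K b) (hr : r ∈ knownCell K c) :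
    ∃ e < 64, s * signedArea p q r ≤ s * signedArea (cellCorner K a e (e / 2))
      (cellCorner K b (e / 4) (e / 8)) (cellCorner K c (e / 16) (e / 32)) := by
  -- The area is affine in each of the six coordinates separately, so they can be moved one after
  -- the other to ends of their intervals without decreasing `F`.
  set F : ℝ → ℝ → ℝ → ℝ → ℝ → ℝ → ℝ := fun x₁ x₂ x₃ x₄ x₅ x₆ =>
    s * signedArea ![x₁, x₂] ![x₃, x₄] ![x₅, x₆] with hF
  have hvec : ∀ v : Fin 2 → ℝ, ![v 0, v 1] = v := fun v => by
    funext i; fin_cases i <;> rfl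
  obtain ⟨e₁, h₁, g₁⟩ := exists_endpoint_ge (f := fun z => F z (p 1) (q 0) (q 1) (r 0) (r 1))
    (fun z => by simp [hF, signedArea]; ring) (hp 0)
  obtain ⟨y₁, hy₁⟩ : ∃ y, y = prefixValue (K a 0) + (e₁ % 2 : ℕ) * (1 / 2 : ℝ) ^ (K a 0).length :=
    ⟨_, rfl⟩
  obtain ⟨e₂, h₂, g₂⟩ := exists_endpoint_ge (f := fun z => F y₁ z (q 0) (q 1) (r 0) (r 1))
    (fun z => by simp [hF, signedArea]; ring) (hp 1)
  obtain ⟨y₂, hy₂⟩ : ∃ y, y = prefixValue (K a 1) + (e₂ % 2 : ℕ) * (1 / 2 : ℝ) ^ (K a 1).length :=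
    ⟨_, rfl⟩
  obtain ⟨e₃, h₃, g₃⟩ := exists_endpoint_ge (f := fun z => F y₁ y₂ z (q 1) (r 0) (r 1))
    (fun z => by simp [hF, signedArea]; ring) (hq 0)
  obtain ⟨y₃, hy₃⟩ : ∃ y, y = prefixValue (K b 0) + (e₃ % 2 : ℕ) * (1 / 2 : ℝ) ^ (K b 0).length :=
    ⟨_, rfl⟩
  obtain ⟨e₄, h₄, g₄⟩ := exists_endpoint_ge (f := fun z => F y₁ y₂ y₃ z (r 0) (r 1))
    (fun z => by simp [hF, signedArea]; ring) (hq 1)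
  obtain ⟨y₄, hy₄⟩ : ∃ y, y = prefixValue (K b 1) + (e₄ % 2 : ℕ) * (1 / 2 : ℝ) ^ (K b 1).length :=
    ⟨_, rfl⟩
  obtain ⟨e₅, h₅, g₅⟩ := exists_endpoint_ge (f := fun z => F y₁ y₂ y₃ y₄ z (r 1))
    (fun z => by simp [hF, signedArea]; ring) (hr 0)
  obtain ⟨y₅, hy₅⟩ : ∃ y, y = prefixValue (K c 0) + (e₅ % 2 : ℕ) * (1 / 2 : ℝ) ^ (K c 0).length :=
    ⟨_, rfl⟩
  obtain ⟨e₆, h₆, g₆⟩ := exists_endpoint_ge (f := fun z => F y₁ y₂ y₃ y₄ y₅ z)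
    (fun z => by simp [hF, signedArea]; ring) (hr 1)
  obtain ⟨y₆, hy₆⟩ : ∃ y, y = prefixValue (K c 1) + (e₆ % 2 : ℕ) * (1 / 2 : ℝ) ^ (K c 1).length :=
    ⟨_, rfl⟩
  simp only [← hy₁] at g₁
  simp only [← hy₂] at g₂
  simp only [← hy₃] at g₃
  simp only [← hy₄] at g₄
  simp only [← hy₅] at g₅
  simp only [← hy₆] at g₆
  have hfin := g₁.trans (g₂.trans (g₃.trans (g₄.trans (g₅.trans g₆))))
  -- The six choices of ends are the binary digits of a single number below 64.
  refine ⟨e₁ + 2 * e₂ + 4 * e₃ + 8 * e₄ + 16 * e₅ + 32 * e₆, by omega, ?_⟩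
  simp only [hF, hvec] at hfin
  refine hfin.trans (le_of_eq ?_)
  unfold cellCorner
  rw [hy₁, hy₂, hy₃, hy₄, hy₅, hy₆]
  generalize he : e₁ + 2 * e₂ + 4 * e₃ + 8 * e₄ + 16 * e₅ + 32 * e₆ = e
  rw [show e % 2 = e₁ % 2 by omega, show e / 2 % 2 = e₂ % 2 by omega,
    show e / 4 % 2 = e₃ % 2 by omega, show e / 8 % 2 = e₄ % 2 by omega,
    show e / 16 % 2 = e₅ % 2 by omega, show e / 32 % 2 = e₆ % 2 by omega]

/-! ### Correctness of the integer computations -/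

/-- The state of knowledge as a list. -/
def Knowledge.toState (K : Knowledge n) : State := List.ofFn fun i => (K i 0, K i 1)

lemma length_toState (K : Knowledge n) : K.toState.length = n := by simp [Knowledge.toState]

lemma coord_toState (K : Knowledge n) (i : Fin n) (c : Fin 2) : K.toState.coord i c = K i c := by
  fin_cases c <;> simp [State.coord, Knowledge.toState]

/-- It makes `2 ^ K.toState.size` a common denominator of all corners: the truncated subtraction in
`State.corner` is a true one. -/
lemma length_le_size (K : Knowledge n) (i : Fin n) (c : Fin 2) :
    (K i c).length ≤ K.toState.size := by
  have h : (K i 0, K i 1) ∈ K.toState := by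
    rw [Knowledge.toState, List.mem_ofFn]; exact ⟨i, rfl⟩
  have h2 : (K i 0 ++ K i 1).Sublist (K.toState.flatMap fun p => p.1 ++ p.2) :=
    List.sublist_flatten_of_mem (List.mem_map_of_mem (f := fun p => p.1 ++ p.2) h)
  have h3 := h2.length_le
  rw [List.length_append] at h3
  unfold State.size
  fin_cases c
  · exact (Nat.le_add_right _ _).trans h3
  · exact (Nat.le_add_left _ _).trans h3

lemma binaryValue_eq (u : List (Fin 2)) :
    (binaryValue u : ℝ) = 2 ^ u.length * prefixValue u := by
  induction u using List.reverseRecOn with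
  | nil => simp [binaryValue, prefixValue]
  | append_singleton u b ih =>
    have : binaryValue (u ++ [b]) = 2 * binaryValue u + b := by simp [binaryValue]
    rw [this, prefixValue_append_singleton, List.length_append, List.length_singleton]
    push_cast
    rw [ih, pow_succ, one_div, inv_pow, pow_succ]
    field_simp

lemma corner_toState (K : Knowledge n) (i : Fin n) (c : Fin 2) (e : ℕ) :
    (K.toState.corner i c e : ℝ) = 2 ^ K.toState.size *
      (prefixValue (K i c) + (e % 2 : ℕ) * (1 / 2 : ℝ) ^ (K i c).length) := by
  have h := length_le_size K i c
  rw [State.corner, coord_toState]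
  push_cast
  rw [binaryValue_eq, pow_sub₀ _ two_ne_zero h, one_div, inv_pow]
  field_simp

/-- The six products of the determinant are grouped by sign to stay within the natural numbers; the
scale is squared because the area is quadratic. -/
lemma areaPos_sub_areaNeg (K : Knowledge n) (a b c : Fin n) (e : ℕ) :
    (K.toState.areaPos a b c e : ℝ) - K.toState.areaNeg a b c e =
      (2 ^ K.toState.size) ^ 2 * signedArea (cellCorner K a e (e / 2))
        (cellCorner K b (e / 4) (e / 8)) (cellCorner K c (e / 16) (e / 32)) := by
  have h0 := fun i e => corner_toState K i 0 e
  have h1 := fun i e => corner_toState K i 1 e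
  simp only [Fin.val_zero, Fin.val_one] at h0 h1
  simp only [State.areaPos, State.areaNeg, signedArea, cellCorner]
  push_cast
  rw [h0, h0, h0, h1, h1, h1]
  ring

lemma areaNeg_le_areaPos_iff (K : Knowledge n) (a b c : Fin n) (e : ℕ) :
    K.toState.areaNeg a b c e ≤ K.toState.areaPos a b c e ↔
      0 ≤ signedArea (cellCorner K a e (e / 2))
        (cellCorner K b (e / 4) (e / 8)) (cellCorner K c (e / 16) (e / 32)) := by
  rw [← Nat.cast_le (α := ℝ), ← sub_nonneg, areaPos_sub_areaNeg]
  exact mul_nonneg_iff_of_pos_left (by positivity)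

lemma areaPos_le_areaNeg_iff (K : Knowledge n) (a b c : Fin n) (e : ℕ) :
    K.toState.areaPos a b c e ≤ K.toState.areaNeg a b c e ↔
      signedArea (cellCorner K a e (e / 2))
        (cellCorner K b (e / 4) (e / 8)) (cellCorner K c (e / 16) (e / 32)) ≤ 0 := by
  rw [← Nat.cast_le (α := ℝ), ← sub_nonpos, areaPos_sub_areaNeg]
  exact mul_nonpos_iff_pos_imp_nonpos.trans ⟨fun h => h.1 (by positivity),
    fun h => ⟨fun _ => h, fun _ => by positivity⟩⟩

/-- Weakly opposite signs at two choices of corners force a zero in between. Conversely the area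
attains its extreme values at corners, so a zero forces both weak signs there. -/
lemma ambiguous_iff_unresolved (K : Knowledge n) (a b c : Fin n) :
    K.toState.Ambiguous a b c ↔ Unresolved K a b c := by
  rw [unresolved_iff, State.Ambiguous]
  simp only [ne_eq, Fin.val_inj, areaNeg_le_areaPos_iff, areaPos_le_areaNeg_iff]
  refine and_congr_right fun _ => ⟨?_, ?_⟩
  · rintro ⟨⟨e, -, he⟩, ⟨f, -, hf⟩⟩
    exact exists_signedArea_eq_zero (cellCorner_mem _ _ _ _) (cellCorner_mem _ _ _ _)
      (cellCorner_mem _ _ _ _) (cellCorner_mem _ _ _ _) (cellCorner_mem _ _ _ _)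
      (cellCorner_mem _ _ _ _) hf he
  · rintro ⟨p, hp, q, hq, r, hr, h⟩
    obtain ⟨e, he, h1⟩ := exists_corner_ge 1 hp hq hr
    obtain ⟨f, hf, h2⟩ := exists_corner_ge (-1) hp hq hr
    rw [h] at h1 h2
    exact ⟨⟨e, he, by linarith⟩, ⟨f, hf, by linarith⟩⟩

/-- The sign computed from the lower left corners of the cells. -/
noncomputable def cornerSign (K : Knowledge n) (a b c : Fin n) : SignType :=
  orientation (cellCorner K a 0 0) (cellCorner K b 0 0) (cellCorner K c 0 0)

lemma sign_toState (K : Knowledge n) (a b c : Fin n) :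
    K.toState.sign a b c = (cornerSign K a b c : ℤ) := by
  have h1 := areaNeg_le_areaPos_iff K a b c 0
  have h2 := areaPos_le_areaNeg_iff K a b c 0
  simp only [Nat.zero_div] at h1 h2
  rw [cornerSign, orientation_eq_sign, State.sign]
  split_ifs with h3 h4
  · rw [sign_pos (not_le.mp (mt h2.mpr (not_le.mpr h3)))]; rfl
  · rw [sign_neg (not_le.mp (mt h1.mpr (not_le.mpr h4)))]; rfl
  · rw [le_antisymm (h2.mp (not_lt.mp h3)) (h1.mp (not_lt.mp h4)), sign_zero]; rfl

/-- Without a zero, the area keeps a constant sign on the product of the cells, so any corners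
reveal it. Triples with a repeated index are flat for all sequences. -/
lemma chirotope_eq_cornerSign {K : Knowledge n} (hK : ¬ ∃ a b c, Unresolved K a b c)
    {P : Fin n → Fin 2 → ℝ} (hP : ∀ i, P i ∈ knownCell K i) :
    chirotope P = fun i j k => cornerSign K i j k := by
  funext a b c
  simp only [chirotope, cornerSign, orientation_eq_sign]
  by_cases hd : a ≠ b ∧ b ≠ c ∧ a ≠ c
  · have hno : ∀ x ∈ knownCell K a, ∀ y ∈ knownCell K b, ∀ z ∈ knownCell K c,
        signedArea x y z ≠ 0 := fun x hx y hy z hz h0 =>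
      hK ⟨a, b, c, unresolved_iff.mpr ⟨hd, x, hx, y, hy, z, hz, h0⟩⟩
    have hC := fun i => cellCorner_mem K i 0 0
    rcases lt_or_gt_of_ne (hno _ (hP a) _ (hP b) _ (hP c)) with h1 | h1 <;>
      rcases lt_or_gt_of_ne (hno _ (hC a) _ (hC b) _ (hC c)) with h2 | h2
    · rw [sign_neg h1, sign_neg h2]
    · obtain ⟨x, hx, y, hy, z, hz, h0⟩ := exists_signedArea_eq_zero (hP a) (hC a) (hP b) (hC b)
        (hP c) (hC c) h1.le h2.le
      exact absurd h0 (hno x hx y hy z hz)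
    · obtain ⟨x, hx, y, hy, z, hz, h0⟩ := exists_signedArea_eq_zero (hC a) (hP a) (hC b) (hP b)
        (hC c) (hP c) h2.le h1.le
      exact absurd h0 (hno x hx y hy z hz)
    · rw [sign_pos h1, sign_pos h2]
  · have h0 : ∀ Q : Fin n → Fin 2 → ℝ, signedArea (Q a) (Q b) (Q c) = 0 := by
      intro Q
      have : a = b ∨ b = c ∨ a = c := by tauto
      rcases this with rfl | rfl | rfl <;> simp only [signedArea] <;> ring
    rw [h0 P, h0 fun i => cellCorner K i 0 0]

/-! ### A computable greedy algorithm -/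

/-- The greedy algorithm that breaks ties by choosing the smallest index. -/
noncomputable def greedyAlgorithm (n : ℕ) : Algorithm n := fun K =>
  if h : K.toState.half < n then Action.read ⟨K.toState.half, h⟩ 1
  else if h : K.toState.selected < n then Action.read ⟨K.toState.selected, h⟩ 0
  else Action.output fun i j k => cornerSign K i j k

lemma code_greedyAlgorithm (n : ℕ) (K : Knowledge n) :
    K.toState.greedyCode = (greedyAlgorithm n K).code := by
  unfold State.greedyCode greedyAlgorithm
  rw [length_toState]
  split_ifs with h1 h2
  · rfl
  · rfl
  · simp only [Action.code, ← sign_toState]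
    congr 1
    have hrange : ∀ {β : Type} (g : ℕ → β),
        (List.range n).map g = List.ofFn fun i : Fin n => g i := by
      intro β g
      rw [List.ofFn_eq_map, ← List.map_coe_finRange_eq_range, List.map_map]
      rfl
    simp only [hrange]

theorem uniformlyComputable_greedyAlgorithm : UniformlyComputable greedyAlgorithm :=
  ⟨State.greedyCode, primrec_greedyCode.to_comp, code_greedyAlgorithm⟩

lemma half_lt_iff {K : Knowledge n} :
    K.toState.half < n ↔ ∃ a < n, K.toState.HalfRead a := by
  have := List.findIdx_lt_length (xs := List.range n)
    (p := fun a => decide (K.toState.HalfRead a))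
  simpa [State.half, length_toState] using this

lemma selected_lt_iff {K : Knowledge n} :
    K.toState.selected < n ↔ ∃ a < n, K.toState.Selectable a := by
  have := List.findIdx_lt_length (xs := List.range n)
    (p := fun a => decide (K.toState.Selectable a))
  simpa [State.selected, length_toState] using this

lemma halfRead_half {K : Knowledge n} (h : K.toState.half < n) :
    K.toState.HalfRead K.toState.half := by
  have h' : (List.range K.toState.length).findIdx (fun a => decide (K.toState.HalfRead a)) <
      (List.range K.toState.length).length := by
    simpa [length_toState, State.half] using h
  have := List.findIdx_getElem (w := h')
  rw [List.getElem_range] at this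
  exact of_decide_eq_true this

lemma selectable_selected {K : Knowledge n} (h : K.toState.selected < n) :
    K.toState.Selectable K.toState.selected := by
  have h' : (List.range K.toState.length).findIdx (fun a => decide (K.toState.Selectable a)) <
      (List.range K.toState.length).length := by
    simpa [length_toState, State.selected] using h
  have := List.findIdx_getElem (w := h')
  rw [List.getElem_range] at this
  exact of_decide_eq_true this

lemma halfRead_iff {K : Knowledge n} (a : Fin n) :
    K.toState.HalfRead a ↔ (K a 0).length = (K a 1).length + 1 := by
  have h0 := coord_toState K a 0
  have h1 := coord_toState K a 1
  simp only [Fin.val_zero, Fin.val_one] at h0 h1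
  rw [State.HalfRead, h0, h1]

lemma selectable_iff {K : Knowledge n} (a : Fin n) :
    K.toState.Selectable a ↔ ∃ b c, Unresolved K a b c ∧
      (K a 0).length ≤ (K b 0).length ∧ (K a 0).length ≤ (K c 0).length := by
  have h0 := fun i => coord_toState K i 0
  simp only [Fin.val_zero] at h0
  simp only [State.Selectable, length_toState]
  constructor
  · rintro ⟨b, hb, c, hc, h1, h2, h3⟩
    have e2 := h0 ⟨b, hb⟩
    have e3 := h0 ⟨c, hc⟩
    simp only at e2 e3
    rw [h0, e2] at h2
    rw [h0, e3] at h3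
    exact ⟨⟨b, hb⟩, ⟨c, hc⟩, (ambiguous_iff_unresolved K _ _ _).mp h1, h2, h3⟩
  · rintro ⟨b, c, h1, h2, h3⟩
    exact ⟨b, b.2, c, c.2, (ambiguous_iff_unresolved K _ _ _).mpr h1, by rwa [h0, h0],
      by rwa [h0, h0]⟩

lemma Unresolved.rotate {K : Knowledge n} {a b c : Fin n} (h : Unresolved K a b c) :
    Unresolved K b c a := by
  obtain ⟨h1, h2, h3, x, v, hv, ha, hb, hc⟩ := h
  exact ⟨h2, h3.symm, h1.symm, x, v, hv, hb, hc, ha⟩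

/-- Every unresolved triple can be ordered so that a point of coarsest resolution comes first. -/
lemma exists_coarsest {K : Knowledge n} (h : ∃ a b c, Unresolved K a b c) :
    ∃ a b c, Unresolved K a b c ∧ (K a 0).length ≤ (K b 0).length ∧
      (K a 0).length ≤ (K c 0).length := by
  obtain ⟨a, b, c, h⟩ := h
  rcases le_total (K a 0).length (K b 0).length with h1 | h1
  · rcases le_total (K a 0).length (K c 0).length with h2 | h2
    · exact ⟨a, b, c, h, h1, h2⟩
    · exact ⟨c, a, b, h.rotate.rotate, h2, h2.trans h1⟩
  · rcases le_total (K b 0).length (K c 0).length with h2 | h2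
    · exact ⟨b, c, a, h.rotate, h2, h1⟩
    · exact ⟨c, a, b, h.rotate.rotate, h2.trans h1, h2⟩

lemma Balanced.half_not_lt {K : Knowledge n} (hK : Balanced K) : ¬ K.toState.half < n := by
  rw [half_lt_iff]
  rintro ⟨a, ha, h⟩
  have := (halfRead_iff ⟨a, ha⟩).mp h
  rw [hK] at this
  omega

theorem isGreedy_greedyAlgorithm (n : ℕ) : IsGreedy (greedyAlgorithm n) where
  select K hK hu := by
    obtain ⟨a, b, c, h, hab, hac⟩ := exists_coarsest hu
    have hs : K.toState.selected < n :=
      selected_lt_iff.mpr ⟨a, a.2, (selectable_iff a).mpr ⟨b, c, h, hab, hac⟩⟩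
    obtain ⟨b', c', h', hb', hc'⟩ :=
      (selectable_iff ⟨K.toState.selected, hs⟩).mp (selectable_selected hs)
    refine ⟨_, b', c', h', hb', hc', ?_⟩
    rw [greedyAlgorithm, dif_neg hK.half_not_lt, dif_pos hs]
  second K i hi hj := by
    have hs : K.toState.half < n := half_lt_iff.mpr ⟨i, i.2, (halfRead_iff i).mpr hi⟩
    have hr := (halfRead_iff ⟨K.toState.half, hs⟩).mp (halfRead_half hs)
    rw [greedyAlgorithm, dif_pos hs]
    congr 1
    -- Only `i` has coordinates of unequal lengths, so the search cannot have found another point.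
    by_contra hne
    rw [hj _ hne] at hr
    omega
  finish K hK hu := by
    refine ⟨fun i j k => cornerSign K i j k, ?_, fun P hP => chirotope_eq_cornerSign hu hP⟩
    rw [greedyAlgorithm, dif_neg hK.half_not_lt, dif_neg]
    rw [selected_lt_iff]
    rintro ⟨a, ha, h⟩
    obtain ⟨b, c, h, -⟩ := (selectable_iff ⟨a, ha⟩).mp h
    exact hu ⟨_, b, c, h⟩

/-! ### Lines that cross a segment -/

/-- The signed distance of a point to the line of ordinate `y` parallel to the axis `d`. -/
def height (d : Fin 2) (σ y : ℝ) (p : Fin 2 → ℝ) : ℝ := σ * (p (1 - d) - y)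

/-- The abscissa of the intersection of the line through `p` and `q` with the line of ordinate `y`
parallel to the axis `d`. -/
noncomputable def crossingPoint (d : Fin 2) (σ y : ℝ) (p q : Fin 2 → ℝ) : ℝ :=
  (p d * height d σ y q - q d * height d σ y p) / (height d σ y q - height d σ y p)

/-- The point `p` lies in a strip parallel to the axis `d`, the point `q` in another one that is
further away, and the line through `p` and `q` crosses the open segment of length `δ`
parallel to the axis `d` that starts at abscissa `s` and ordinate `y`. -/
def Crosses (d : Fin 2) (σ y s δ : ℝ) (p q : Fin 2 → ℝ) : Prop :=
  height d σ y p ∈ Set.Icc (1 / 8) (1 / 4) ∧ height d σ y q ∈ Set.Icc (3 / 8) (1 / 2) ∧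
    crossingPoint d σ y p q ∈ Set.Ioo s (s + δ)

/-- A nonempty open part of the cube has positive volume. This is how an almost sure property is
used at chosen configurations. -/
lemma exists_mem_of_ae {p : (Fin n → Fin 2 → ℝ) → Prop} (h : ∀ᵐ P ∂(uniformSample n), p P)
    {V : Set (Fin n → Fin 2 → ℝ)} (hV : IsOpen V) (hne : V.Nonempty)
    (hsub : ∀ P ∈ V, ∀ i c, P i c ∈ Set.Icc (0 : ℝ) 1) : ∃ P ∈ V, p P := by
  by_contra! hno
  have h0 : uniformSample n V = 0 := measure_mono_null (fun P hP => hno P hP) h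
  rw [uniformSample_eq_restrict, Measure.restrict_apply hV.measurableSet,
    Set.inter_eq_left.mpr] at h0
  · exact (hV.measure_pos volume hne).ne' h0
  · exact fun P hP i _ => ⟨fun c => (hsub P hP i c).1, fun c => (hsub P hP i c).2⟩

/-- The samples whose coordinates are interior to the known dyadic intervals. -/
def openBox (K : Knowledge n) : Set (Fin n → Fin 2 → ℝ) :=
  {Q | ∀ j c, Q j c ∈ Set.Ioo (prefixValue (K j c))
    (prefixValue (K j c) + (1 / 2 : ℝ) ^ (K j c).length)}

lemma isOpen_openBox (K : Knowledge n) : IsOpen (openBox K) := by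
  have : openBox K = ⋂ j, ⋂ c, (fun Q : Fin n → Fin 2 → ℝ => Q j c) ⁻¹'
      Set.Ioo (prefixValue (K j c)) (prefixValue (K j c) + (1 / 2 : ℝ) ^ (K j c).length) := by
    ext Q; simp [openBox]
  rw [this]
  refine isOpen_iInter_of_finite fun j => isOpen_iInter_of_finite fun c => ?_
  exact isOpen_Ioo.preimage (by fun_prop)

lemma openBox_subset_Icc (K : Knowledge n) {Q : Fin n → Fin 2 → ℝ} (hQ : Q ∈ openBox K) (j : Fin n)
    (c : Fin 2) : Q j c ∈ Set.Icc (0 : ℝ) 1 :=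
  ⟨(prefixValue_nonneg _).trans (hQ j c).1.le, (hQ j c).2.le.trans (prefixValue_add_le_one _)⟩

/-- When an algorithm that determines the chirotope stops, the samples that have the announced
chirotope are dense in the box that is known to contain the sample. -/
lemma DeterminesChirotope.exists_chirotope_eq {A : Algorithm n} (hA : DeterminesChirotope A)
    {w : Input n} {t : ℕ} {χ : Signs n} (ht : A (knowledge A w t) = Action.output χ)
    {V : Set (Fin n → Fin 2 → ℝ)} (hV : IsOpen V) (hne : (V ∩ openBox (knowledge A w t)).Nonempty) :
    ∃ Q ∈ V, chirotope Q = χ := by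
  obtain ⟨Q, hQ, hout⟩ := exists_mem_of_ae hA (hV.inter (isOpen_openBox (knowledge A w t))) hne
    fun P hP => openBox_subset_Icc _ hP.2
  refine ⟨Q, hQ.1, hout.unique ⟨t, ?_⟩⟩
  rw [knowledge_congr A (w' := inputOf Q) (fun i c => streamPrefix_bits_of_mem_Ioo (hQ.2 i c)) t
    le_rfl, ht]

/-- As `r` slides along the line of ordinate `y`, the area is affine in its abscissa and vanishes at
the crossing point. -/
lemma signedArea_eq_crossingPoint {d : Fin 2} {σ y : ℝ} {p q r : Fin 2 → ℝ}
    (hr : r (1 - d) = y) (h : height d σ y q - height d σ y p ≠ 0) :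
    signedArea p q r = (if d = 0 then -1 else 1) * (q (1 - d) - p (1 - d)) *
      (r d - crossingPoint d σ y p q) := by
  have hne : q (1 - d) - p (1 - d) ≠ 0 := by
    intro h0
    apply h
    unfold height
    linear_combination σ * h0
  have hc : crossingPoint d σ y p q =
      (p d * (q (1 - d) - y) - q d * (p (1 - d) - y)) / (q (1 - d) - p (1 - d)) := by
    unfold crossingPoint
    rw [div_eq_div_iff h hne]
    unfold height
    ring
  rw [hc]
  fin_cases d
  · simp at hne hr ⊢
    unfold signedArea
    field_simp
    rw [hr]
    ring
  · simp at hne hr ⊢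
    unfold signedArea
    field_simp
    rw [hr]
    ring

/-- The end points of dyadic intervals. -/
def dyadicEnds : Set ℝ :=
  Set.range prefixValue ∪ Set.range fun u : List (Fin 2) => prefixValue u + (1 / 2 : ℝ) ^ u.length

lemma countable_dyadicEnds : dyadicEnds.Countable :=
  (Set.countable_range _).union (Set.countable_range _)

lemma ae_notMem_dyadicEnds : ∀ᵐ P ∂(uniformSample n), ∀ j c, P j c ∉ dyadicEnds := by
  simp_rw [ae_all_iff]
  intro j c
  refine measure_eq_zero_iff_ae_notMem (s := {P : Fin n → Fin 2 → ℝ | P j c ∈ dyadicEnds}).mp ?_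
  refine nonpos_iff_eq_zero.mp (measure_le_of_coord j c ?_ fun P => ?_)
  · exact measurable_eval_eval j c countable_dyadicEnds.measurableSet
  · refine (measure_mono (t := dyadicEnds) fun z hz => ?_).trans_eq
      (countable_dyadicEnds.measure_zero volume)
    simpa using hz

lemma mem_openBox_knowledge (A : Algorithm n) {P : Fin n → Fin 2 → ℝ}
    (hP : ∀ i c, P i c ∈ Set.Icc (0 : ℝ) 1) (hd : ∀ i c, P i c ∉ dyadicEnds) (t : ℕ) :
    P ∈ openBox (knowledge A (inputOf P) t) := by
  intro j c
  have h := points_mem_knownCell A (inputOf P) t j c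
  rw [points_inputOf hP] at h
  refine ⟨lt_of_le_of_ne h.1 fun h0 => ?_, lt_of_le_of_ne h.2 fun h0 => ?_⟩
  · exact hd j c (Or.inl ⟨_, h0⟩)
  · exact hd j c (Or.inr ⟨_, h0.symm⟩)

/-- If a line through two points crosses the dyadic segment of length `2 ^ (-k)` around a third
point, then more than `k` bits of a coordinate of this point have been read. -/
lemma DeterminesChirotope.lt_length_of_crosses {A : Algorithm n} (hA : DeterminesChirotope A)
    {P : Fin n → Fin 2 → ℝ} (hP : ∀ i c, P i c ∈ Set.Icc (0 : ℝ) 1)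
    (hd : ∀ i c, P i c ∉ dyadicEnds) {a b i : Fin n} (hai : a ≠ i) (hbi : b ≠ i)
    {d : Fin 2} {σ : ℝ} {k : ℕ}
    (hcross : Crosses d σ (P i (1 - d)) (dyadicFloor k (P i d)) ((1 / 2) ^ k) (P a) (P b))
    {t : ℕ} {χ : Signs n} (ht : A (knowledge A (inputOf P) t) = Action.output χ) :
    k < (knowledge A (inputOf P) t i d).length := by
  by_contra! hlen
  obtain ⟨h1, h2, h3⟩ := hcross
  set x := crossingPoint d σ (P i (1 - d)) (P a) (P b) with hx
  have hh : height d σ (P i (1 - d)) (P b) - height d σ (P i (1 - d)) (P a) ≠ 0 := by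
    have := h1.2; have := h2.1
    intro h0; linarith
  set κ : ℝ := (if d = 0 then -1 else 1) * (P b (1 - d) - P a (1 - d)) with hκ
  have hκ0 : κ ≠ 0 := by
    refine mul_ne_zero (by split_ifs <;> norm_num) fun h0 => hh ?_
    unfold height
    linear_combination σ * h0
  have hbox := mem_openBox_knowledge A hP hd t
  -- With at most `k` bits known, the whole open dyadic segment stays inside the known box; along it
  -- the area is affine with its zero at `x`.
  have hmem : ∀ z ∈ Set.Ioo (dyadicFloor k (P i d)) (dyadicFloor k (P i d) + (1 / 2) ^ k),
      setCoord P i d z ∈ openBox (knowledge A (inputOf P) t) ∧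
      signedArea (setCoord P i d z a) (setCoord P i d z b) (setCoord P i d z i) = κ * (z - x) := by
    intro z hz
    constructor
    · intro j c
      by_cases hj : j = i
      · subst hj
        by_cases hc : c = d
        · subst hc
          rw [setCoord_self]
          have hle := streamPrefix_Icc_anti (bits (P j c)) hlen
          have hk := knowledge_eq_streamPrefix A (inputOf P) t j c
          rw [show streamPrefix (bits (P j c)) (knowledge A (inputOf P) t j c).length =
            knowledge A (inputOf P) t j c from hk.symm] at hle
          exact ⟨lt_of_le_of_lt hle.1 hz.1, lt_of_lt_of_le hz.2 hle.2⟩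
        · rw [setCoord_of_ne_axis P j z hc]; exact hbox j c
      · rw [setCoord_of_ne P d z hj]; exact hbox j c
    · rw [setCoord_of_ne P d z hai, setCoord_of_ne P d z hbi]
      rw [signedArea_eq_crossingPoint (setCoord_of_ne_axis P i z (one_sub_ne_self d)) hh,
        setCoord_self]
  have hcont : Continuous fun Q : Fin n → Fin 2 → ℝ => signedArea (Q a) (Q b) (Q i) := by
    unfold signedArea; fun_prop
  -- Positions on both sides of `x` give two open sets of samples with opposite orientations; both
  -- meet the known box, so each contains a sample with the announced chirotope.
  obtain ⟨z₁, hz₁, hz₁'⟩ := exists_between h3.1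
  obtain ⟨z₂, hz₂, hz₂'⟩ := exists_between h3.2
  obtain ⟨m₁, s₁⟩ := hmem z₁ ⟨hz₁, hz₁'.trans h3.2⟩
  obtain ⟨m₂, s₂⟩ := hmem z₂ ⟨h3.1.trans hz₂, hz₂'⟩
  have hopen1 : IsOpen {Q : Fin n → Fin 2 → ℝ | κ * signedArea (Q a) (Q b) (Q i) < 0} :=
    isOpen_lt (continuous_const.mul hcont) continuous_const
  have hopen2 : IsOpen {Q : Fin n → Fin 2 → ℝ | 0 < κ * signedArea (Q a) (Q b) (Q i)} :=
    isOpen_lt continuous_const (continuous_const.mul hcont)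
  have hκ2 : 0 < κ * κ := mul_self_pos.mpr hκ0
  obtain ⟨Q₁, hQ₁, hχ₁⟩ := hA.exists_chirotope_eq ht hopen1 ⟨_, by
    simp only [Set.mem_ofPred_eq, s₁]
    nlinarith, m₁⟩
  obtain ⟨Q₂, hQ₂, hχ₂⟩ := hA.exists_chirotope_eq ht hopen2 ⟨_, by
    simp only [Set.mem_ofPred_eq, s₂]
    nlinarith, m₂⟩
  have heq : SignType.sign (signedArea (Q₁ a) (Q₁ b) (Q₁ i)) =
      SignType.sign (signedArea (Q₂ a) (Q₂ b) (Q₂ i)) := by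
    rw [← orientation_eq_sign, ← orientation_eq_sign]
    exact congrFun (congrFun (congrFun (hχ₁.trans hχ₂.symm) a) b) i
  have h4 : SignType.sign (κ * signedArea (Q₁ a) (Q₁ b) (Q₁ i)) =
      SignType.sign (κ * signedArea (Q₂ a) (Q₂ b) (Q₂ i)) := by rw [sign_mul κ, sign_mul κ, heq]
  rw [sign_neg hQ₁, sign_pos hQ₂] at h4
  exact absurd h4 (by decide)

/-- The set `T` does not depend on the coordinate integrated out, so `B` is a lower bound for the
conditional probability of `S` given `T`. -/
lemma mul_measure_le_of_coord (c : Fin n) (d : Fin 2) {S T : Set (Fin n → Fin 2 → ℝ)}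
    (hS : MeasurableSet S) (hT : MeasurableSet T) {B : ℝ≥0∞}
    (hTc : ∀ P z, setCoord P c d z ∈ T ↔ P ∈ T)
    (h : ∀ P ∈ T, B ≤ volume ({z | setCoord P c d z ∈ S} ∩ Set.Icc 0 1)) :
    B * uniformSample n T ≤ uniformSample n S := by
  have := lintegral_le_of_coord c d (f := T.indicator fun _ => B) (g := S.indicator 1)
    (measurable_const.indicator hT) (measurable_one.indicator hS) ?_
  · rwa [lintegral_indicator_one hS, lintegral_indicator_const hT] at this
  · intro P
    have e : ∫⁻ z in Set.Icc 0 1, S.indicator (1 : (Fin n → Fin 2 → ℝ) → ℝ≥0∞) (setCoord P c d z) =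
        ∫⁻ z in Set.Icc 0 1, (setCoord P c d ⁻¹' S).indicator 1 z := rfl
    rw [e, lintegral_indicator_one (measurable_setCoord P c d hS),
      Measure.restrict_apply (measurable_setCoord P c d hS)]
    by_cases hP : P ∈ T
    · simp only [Set.indicator_of_mem ((hTc P _).mpr hP)]
      rw [lintegral_const, measure_univ, mul_one]
      exact h P hP
    · simp only [Set.indicator_of_notMem (mt (hTc P _).mp hP)]
      simp

lemma measure_le_mul_of_coord (c : Fin n) (d : Fin 2) {S T : Set (Fin n → Fin 2 → ℝ)}
    (hS : MeasurableSet S) (hT : MeasurableSet T) {B : ℝ≥0∞} (hST : S ⊆ T)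
    (hTc : ∀ P z, setCoord P c d z ∈ T ↔ P ∈ T)
    (h : ∀ P ∈ T, volume {z | setCoord P c d z ∈ S} ≤ B) :
    uniformSample n S ≤ B * uniformSample n T := by
  have := lintegral_le_of_coord c d (f := S.indicator 1) (g := T.indicator fun _ => B)
    (measurable_one.indicator hS) (measurable_const.indicator hT) ?_
  · rwa [lintegral_indicator_one hS, lintegral_indicator_const hT] at this
  · intro P
    have e : ∫⁻ z in Set.Icc 0 1, S.indicator (1 : (Fin n → Fin 2 → ℝ) → ℝ≥0∞) (setCoord P c d z) =
        ∫⁻ z in Set.Icc 0 1, (setCoord P c d ⁻¹' S).indicator 1 z := rfl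
    rw [e, lintegral_indicator_one (measurable_setCoord P c d hS)]
    by_cases hP : P ∈ T
    · simp only [Set.indicator_of_mem ((hTc P _).mpr hP)]
      rw [lintegral_const, measure_univ, mul_one]
      exact (Measure.restrict_apply_le _ _).trans (h P hP)
    · have : setCoord P c d ⁻¹' S = ∅ := by
        ext z
        simp only [Set.mem_preimage, Set.mem_empty_iff_false, iff_false]
        exact fun hz => hP ((hTc P z).mp (hST hz))
      rw [this]
      simp

/-! ### The probability that a line through two random points crosses a segment -/

/-- Samples for which the line through the points `a` and `b` crosses a given segment. -/
def crossEvent (d : Fin 2) (σ y s δ : ℝ) (a b : Fin n) : Set (Fin n → Fin 2 → ℝ) :=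
  {P | Crosses d σ y s δ (P a) (P b)}

lemma measurable_height (d : Fin 2) (σ y : ℝ) : Measurable (height d σ y) := by
  unfold height; fun_prop

lemma measurableSet_crosses (d : Fin 2) (σ y s δ : ℝ) :
    MeasurableSet {p : (Fin 2 → ℝ) × (Fin 2 → ℝ) | Crosses d σ y s δ p.1 p.2} := by
  have h1 : Measurable fun p : (Fin 2 → ℝ) × (Fin 2 → ℝ) => height d σ y p.1 :=
    (measurable_height d σ y).comp measurable_fst
  have h2 : Measurable fun p : (Fin 2 → ℝ) × (Fin 2 → ℝ) => height d σ y p.2 :=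
    (measurable_height d σ y).comp measurable_snd
  have h3 : Measurable fun p : (Fin 2 → ℝ) × (Fin 2 → ℝ) => crossingPoint d σ y p.1 p.2 := by
    unfold crossingPoint
    have h4 : Measurable fun p : (Fin 2 → ℝ) × (Fin 2 → ℝ) => p.1 d := by fun_prop
    have h5 : Measurable fun p : (Fin 2 → ℝ) × (Fin 2 → ℝ) => p.2 d := by fun_prop
    exact ((h4.mul h2).sub (h5.mul h1)).div (h2.sub h1)
  exact (h1 measurableSet_Icc).inter ((h2 measurableSet_Icc).inter (h3 measurableSet_Ioo))

lemma measurableSet_crossEvent (d : Fin 2) (σ y s δ : ℝ) (a b : Fin n) :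
    MeasurableSet (crossEvent d σ y s δ a b) := by
  have h : Measurable fun P : Fin n → Fin 2 → ℝ => (P a, P b) :=
    (measurable_pi_apply a).prodMk (measurable_pi_apply b)
  exact h (measurableSet_crosses d σ y s δ)

lemma height_setCoord (d : Fin 2) (σ y : ℝ) (P : Fin n → Fin 2 → ℝ) (c j : Fin n) (z : ℝ) :
    height d σ y (setCoord P c d z j) = height d σ y (P j) := by
  unfold height
  by_cases h : j = c
  · subst h; rw [setCoord_of_ne_axis P j z (one_sub_ne_self d)]
  · rw [setCoord_of_ne P d z h]

/-- The crossing point is affine in the abscissa of `a`. With heights `p < q`, the admissible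
abscissas form an interval of length `δ (q - p) / q`, which is at most `δ` and at least `δ / 4`. -/
lemma setOf_crosses_fst {d : Fin 2} {σ y s δ : ℝ} {P : Fin n → Fin 2 → ℝ} {a b : Fin n}
    (hab : a ≠ b) (ha : height d σ y (P a) ∈ Set.Icc (1 / 8) (1 / 4))
    (hb : height d σ y (P b) ∈ Set.Icc (3 / 8) (1 / 2)) :
    {z | setCoord P a d z ∈ crossEvent d σ y s δ a b} =
      Set.Ioo ((s * (height d σ y (P b) - height d σ y (P a)) + P b d * height d σ y (P a)) /
          height d σ y (P b))
        (((s + δ) * (height d σ y (P b) - height d σ y (P a)) + P b d * height d σ y (P a)) /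
          height d σ y (P b)) := by
  ext z
  simp only [crossEvent, Crosses, Set.mem_ofPred_eq, height_setCoord, ha, hb, true_and,
    crossingPoint, setCoord_self, setCoord_of_ne P d z hab.symm, Set.mem_Ioo]
  have h1 : 0 < height d σ y (P b) - height d σ y (P a) := by linarith [ha.2, hb.1]
  have h2 : 0 < height d σ y (P b) := by linarith [hb.1]
  rw [lt_div_iff₀ h1, div_lt_iff₀ h1, div_lt_iff₀ h2, lt_div_iff₀ h2]
  constructor <;> rintro ⟨h3, h4⟩ <;> constructor <;> linarith

/-- Here the length is `δ (q - p) / p`, at most `3 * δ` since `p ≥ 1/8` and `q ≤ 1/2`. -/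
lemma setOf_crosses_snd {d : Fin 2} {σ y s δ : ℝ} {P : Fin n → Fin 2 → ℝ} {a b : Fin n}
    (hab : a ≠ b) (ha : height d σ y (P a) ∈ Set.Icc (1 / 8) (1 / 4))
    (hb : height d σ y (P b) ∈ Set.Icc (3 / 8) (1 / 2)) :
    {z | setCoord P b d z ∈ crossEvent d σ y s δ a b} =
      Set.Ioo ((P a d * height d σ y (P b) - (s + δ) * (height d σ y (P b) - height d σ y (P a))) /
          height d σ y (P a))
        ((P a d * height d σ y (P b) - s * (height d σ y (P b) - height d σ y (P a))) /
          height d σ y (P a)) := by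
  ext z
  simp only [crossEvent, Crosses, Set.mem_ofPred_eq, height_setCoord, ha, hb, true_and,
    crossingPoint, setCoord_self, setCoord_of_ne P d z hab, Set.mem_Ioo]
  have h1 : 0 < height d σ y (P b) - height d σ y (P a) := by linarith [ha.2, hb.1]
  have h2 : 0 < height d σ y (P a) := by linarith [ha.1]
  rw [lt_div_iff₀ h1, div_lt_iff₀ h1, div_lt_iff₀ h2, lt_div_iff₀ h2]
  constructor <;> rintro ⟨h3, h4⟩ <;> constructor <;> linarith

lemma volume_crosses_fst_le {d : Fin 2} {σ y s δ : ℝ} (hδ : 0 ≤ δ) (P : Fin n → Fin 2 → ℝ)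
    {a b : Fin n} (hab : a ≠ b) :
    volume {z | setCoord P a d z ∈ crossEvent d σ y s δ a b} ≤ ENNReal.ofReal δ := by
  by_cases h : height d σ y (P a) ∈ Set.Icc (1 / 8) (1 / 4) ∧
      height d σ y (P b) ∈ Set.Icc (3 / 8) (1 / 2)
  · rw [setOf_crosses_fst hab h.1 h.2, Real.volume_Ioo]
    refine ENNReal.ofReal_le_ofReal ?_
    have h1 := h.1.1
    have h2 := h.2.1
    rw [← sub_div, div_le_iff₀ (by linarith)]
    nlinarith
  · have : {z | setCoord P a d z ∈ crossEvent d σ y s δ a b} = ∅ := by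
      ext z
      simp only [crossEvent, Crosses, Set.mem_ofPred_eq, height_setCoord,
        Set.mem_empty_iff_false, iff_false]
      exact fun h' => h ⟨h'.1, h'.2.1⟩
    simp [this]

lemma volume_crosses_snd_le {d : Fin 2} {σ y s δ : ℝ} (hδ : 0 ≤ δ) (P : Fin n → Fin 2 → ℝ)
    {a b : Fin n} (hab : a ≠ b) :
    volume {z | setCoord P b d z ∈ crossEvent d σ y s δ a b} ≤ ENNReal.ofReal (3 * δ) := by
  by_cases h : height d σ y (P a) ∈ Set.Icc (1 / 8) (1 / 4) ∧
      height d σ y (P b) ∈ Set.Icc (3 / 8) (1 / 2)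
  · rw [setOf_crosses_snd hab h.1 h.2, Real.volume_Ioo]
    refine ENNReal.ofReal_le_ofReal ?_
    have h1 := h.1.1
    have h2 := h.2.2
    rw [← sub_div, div_le_iff₀ (by linarith)]
    nlinarith
  · have : {z | setCoord P b d z ∈ crossEvent d σ y s δ a b} = ∅ := by
      ext z
      simp only [crossEvent, Crosses, Set.mem_ofPred_eq, height_setCoord,
        Set.mem_empty_iff_false, iff_false]
      exact fun h' => h ⟨h'.1, h'.2.1⟩
    simp [this]

lemma setCoord_mem_crossEvent {d : Fin 2} {σ y s δ : ℝ} {a b c : Fin n} (hac : a ≠ c) (hbc : b ≠ c)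
    (P : Fin n → Fin 2 → ℝ) (z : ℝ) :
    setCoord P c d z ∈ crossEvent d σ y s δ a b ↔ P ∈ crossEvent d σ y s δ a b := by
  simp only [crossEvent, Set.mem_ofPred_eq, setCoord_of_ne P d z hac, setCoord_of_ne P d z hbc]

lemma measure_crossEvent_le {d : Fin 2} {σ y s δ : ℝ} (hδ : 0 ≤ δ) {a b : Fin n} (hab : a ≠ b) :
    uniformSample n (crossEvent d σ y s δ a b) ≤ ENNReal.ofReal δ :=
  measure_le_of_coord a d (measurableSet_crossEvent d σ y s δ a b)
    fun P => volume_crosses_fst_le hδ P hab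

/-- Given that the line through `a` and `b'` crosses, the abscissa of `b` is still free, which
contributes a further factor `3 * δ`. -/
lemma measure_crossEvent_inter_fst_le {d : Fin 2} {σ y s δ : ℝ} (hδ : 0 ≤ δ) {a b b' : Fin n}
    (hab : a ≠ b) (hab' : a ≠ b') (hbb' : b ≠ b') :
    uniformSample n (crossEvent d σ y s δ a b ∩ crossEvent d σ y s δ a b') ≤
      ENNReal.ofReal (3 * δ ^ 2) := by
  refine (measure_le_mul_of_coord b d (B := ENNReal.ofReal (3 * δ))
    ((measurableSet_crossEvent d σ y s δ a b).inter (measurableSet_crossEvent d σ y s δ a b'))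
    (measurableSet_crossEvent d σ y s δ a b') Set.inter_subset_right
    (setCoord_mem_crossEvent hab hbb'.symm) fun P _ => (measure_mono fun z hz => hz.1).trans
      (volume_crosses_snd_le hδ P hab)).trans ?_
  refine (mul_le_mul_right (measure_crossEvent_le hδ hab') _).trans ?_
  rw [← ENNReal.ofReal_mul (by positivity)]
  exact ENNReal.ofReal_le_ofReal (by ring_nf; rfl)

lemma measure_crossEvent_inter_snd_le {d : Fin 2} {σ y s δ : ℝ} (hδ : 0 ≤ δ) {a a' b : Fin n}
    (hab : a ≠ b) (hab' : a' ≠ b) (haa' : a ≠ a') :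
    uniformSample n (crossEvent d σ y s δ a b ∩ crossEvent d σ y s δ a' b) ≤
      ENNReal.ofReal (3 * δ ^ 2) := by
  refine (measure_le_mul_of_coord a d (B := ENNReal.ofReal δ)
    ((measurableSet_crossEvent d σ y s δ a b).inter (measurableSet_crossEvent d σ y s δ a' b))
    (measurableSet_crossEvent d σ y s δ a' b) Set.inter_subset_right
    (setCoord_mem_crossEvent haa'.symm hab.symm) fun P _ => (measure_mono fun z hz => hz.1).trans
      (volume_crosses_fst_le hδ P hab)).trans ?_
  refine (mul_le_mul_right (measure_crossEvent_le hδ hab') _).trans ?_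
  rw [← ENNReal.ofReal_mul hδ]
  exact ENNReal.ofReal_le_ofReal (by nlinarith [sq_nonneg δ])

/-- The strips parallel to an axis lie within the unit square. -/
lemma le_volume_strip {σ y : ℝ} (hσ : (σ = 1 ∧ 0 ≤ y ∧ y ≤ 1 / 2) ∨ (σ = -1 ∧ 1 / 2 ≤ y ∧ y ≤ 1))
    {α β : ℝ} (hα : 0 ≤ α) (hβ : β ≤ 1 / 2) :
    ENNReal.ofReal (β - α) ≤ volume ({z | σ * (z - y) ∈ Set.Icc α β} ∩ Set.Icc 0 1) := by
  rcases hσ with ⟨rfl, h1, h2⟩ | ⟨rfl, h1, h2⟩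
  · refine le_trans (le_of_eq ?_) (measure_mono (s := Set.Icc (y + α) (y + β)) ?_)
    · rw [Real.volume_Icc]; congr 1; ring
    · rintro z ⟨h3, h4⟩
      exact ⟨⟨by linarith, by linarith⟩, by linarith, by linarith⟩
  · refine le_trans (le_of_eq ?_) (measure_mono (s := Set.Icc (y - β) (y - α)) ?_)
    · rw [Real.volume_Icc]; congr 1; ring
    · rintro z ⟨h3, h4⟩
      exact ⟨⟨by linarith, by linarith⟩, by linarith, by linarith⟩

/-- Each of the two ordinates falls in its strip with probability at least `1/8`, and then the
abscissa of `a` is suitable with probability at least `δ / 4`; the product is `δ / 256`. -/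
lemma le_measure_crossEvent {d : Fin 2} {σ y s δ : ℝ}
    (hσ : (σ = 1 ∧ 0 ≤ y ∧ y ≤ 1 / 2) ∨ (σ = -1 ∧ 1 / 2 ≤ y ∧ y ≤ 1)) (hs : 0 ≤ s) (hδ : 0 ≤ δ)
    (hsδ : s + δ ≤ 1) {a b : Fin n} (hab : a ≠ b) :
    ENNReal.ofReal (δ / 256) ≤ uniformSample n (crossEvent d σ y s δ a b) := by
  have hm : ∀ j : Fin n, Measurable fun P : Fin n → Fin 2 → ℝ => height d σ y (P j) :=
    fun j => (measurable_height d σ y).comp (measurable_pi_apply j)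
  set T₃ : Set (Fin n → Fin 2 → ℝ) := {P | P b d ∈ Set.Icc (0 : ℝ) 1} with hT₃
  set T₂ : Set (Fin n → Fin 2 → ℝ) := {P | height d σ y (P b) ∈ Set.Icc (3 / 8) (1 / 2)} ∩ T₃
    with hT₂
  set T₁ : Set (Fin n → Fin 2 → ℝ) := {P | height d σ y (P a) ∈ Set.Icc (1 / 8) (1 / 4)} ∩ T₂
    with hT₁
  have m₃ : MeasurableSet T₃ := measurable_eval_eval b d measurableSet_Icc
  have m₂ : MeasurableSet T₂ := (hm b measurableSet_Icc).inter m₃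
  have m₁ : MeasurableSet T₁ := (hm a measurableSet_Icc).inter m₂
  have e₃ : uniformSample n T₃ = 1 := (mem_ae_iff_prob_eq_one m₃).mp <| by
    filter_upwards [ae_mem_Icc (n := n)] with P hP using hP b d
  have e₂ : ENNReal.ofReal (1 / 8) * uniformSample n T₃ ≤ uniformSample n T₂ := by
    refine mul_measure_le_of_coord b (1 - d) m₂ m₃ (fun P z => ?_) fun P hP => ?_
    · simp only [hT₃, Set.mem_ofPred_eq, setCoord_of_ne_axis P b z (one_sub_ne_self d).symm]
    · refine (le_of_eq ?_).trans ((le_volume_strip hσ (α := 3 / 8) (β := 1 / 2) (by norm_num)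
        (by norm_num)).trans (measure_mono ?_))
      · norm_num
      · rintro z ⟨hz, hz'⟩
        refine ⟨⟨?_, ?_⟩, hz'⟩
        · simpa [height] using hz
        · simpa only [hT₃, Set.mem_ofPred_eq,
            setCoord_of_ne_axis P b z (one_sub_ne_self d).symm] using hP
  have e₁ : ENNReal.ofReal (1 / 8) * uniformSample n T₂ ≤ uniformSample n T₁ := by
    have hinv : ∀ P z, setCoord P a (1 - d) z ∈ T₂ ↔ P ∈ T₂ := fun P z => by
      simp only [hT₂, hT₃, Set.mem_inter_iff, Set.mem_ofPred_eq,
        setCoord_of_ne P (1 - d) z hab.symm]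
    refine mul_measure_le_of_coord a (1 - d) m₁ m₂ hinv fun P hP => ?_
    refine (le_of_eq ?_).trans ((le_volume_strip hσ (α := 1 / 8) (β := 1 / 4) (by norm_num)
      (by norm_num)).trans (measure_mono ?_))
    · norm_num
    · rintro z ⟨hz, hz'⟩
      refine ⟨⟨?_, (hinv P z).mpr hP⟩, hz'⟩
      simpa [height] using hz
  have e₀ : ENNReal.ofReal (δ / 4) * uniformSample n T₁ ≤
      uniformSample n (crossEvent d σ y s δ a b) := by
    refine mul_measure_le_of_coord a d (measurableSet_crossEvent d σ y s δ a b) m₁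
      (fun P z => ?_) fun P hP => ?_
    · simp only [hT₁, hT₂, hT₃, Set.mem_inter_iff, Set.mem_ofPred_eq, height_setCoord,
        setCoord_of_ne P d z hab.symm]
    · obtain ⟨ha, hb, hc⟩ := hP
      have ha1 := ha.1
      have ha2 := ha.2
      have hb1 := hb.1
      have hb2 := hb.2
      have hc0 := hc.1
      have hc1 := hc.2
      rw [setOf_crosses_fst hab ha hb, Set.inter_eq_left.mpr, Real.volume_Ioo]
      · refine ENNReal.ofReal_le_ofReal ?_
        rw [← sub_div, le_div_iff₀ (by linarith)]
        nlinarith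
      -- The ends are convex combinations of `P b d` with `s` and with `s + δ`, hence in the unit
      -- interval: `a` lies between the crossing point and `b`.
      · generalize height d σ y (P a) = p at *
        generalize height d σ y (P b) = q at *
        refine Set.Ioo_subset_Icc_self.trans (Set.Icc_subset_Icc ?_ ?_)
        · exact div_nonneg (add_nonneg (mul_nonneg hs (by linarith))
            (mul_nonneg hc0 (by linarith))) (by linarith)
        · rw [div_le_one (by linarith)]
          nlinarith
  calc ENNReal.ofReal (δ / 256)
      = ENNReal.ofReal (δ / 4) * (ENNReal.ofReal (1 / 8) * (ENNReal.ofReal (1 / 8) * 1)) := by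
        rw [mul_one, ← ENNReal.ofReal_mul (by norm_num), ← ENNReal.ofReal_mul (by positivity)]
        congr 1; ring
    _ ≤ _ := by
        rw [← e₃]
        exact (mul_le_mul_right ((mul_le_mul_right e₂ _).trans e₁) _).trans e₀

/-! ### The second moment method -/

section SecondMoment

open ProbabilityTheory

variable {Ω ι : Type*} [MeasurableSpace Ω] {μ : Measure Ω} [IsProbabilityMeasure μ]

lemma memLp_indicator_one {E : Set Ω} (hE : MeasurableSet E) :
    MemLp (E.indicator (1 : Ω → ℝ)) 2 μ :=
  memLp_indicator_const 2 hE (1 : ℝ) (Or.inr (measure_ne_top μ E))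

lemma covariance_indicator_le {E F : Set Ω} (hE : MeasurableSet E) (hF : MeasurableSet F) :
    cov[E.indicator (1 : Ω → ℝ), F.indicator (1 : Ω → ℝ); μ] ≤ μ.real (E ∩ F) := by
  rw [covariance_eq_sub (memLp_indicator_one hE) (memLp_indicator_one hF)]
  rw [← Set.inter_indicator_one, integral_indicator_one (hE.inter hF), integral_indicator_one hE,
    integral_indicator_one hF]
  have : 0 ≤ μ.real E * μ.real F := by positivity
  linarith

/-- If the sum of the covariances of some events is small then one of them is likely to occur. -/
lemma measure_forall_notMem_le {s : Finset ι} {E : ι → Set Ω} (hE : ∀ x, MeasurableSet (E x))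
    {p V : ℝ} (hp : 0 < p) (hs : s.Nonempty) (hpE : ∀ x ∈ s, p ≤ μ.real (E x))
    (hV : ∑ x ∈ s, ∑ y ∈ s,
      cov[(E x).indicator (1 : Ω → ℝ), (E y).indicator (1 : Ω → ℝ); μ] ≤ V) :
    μ {ω | ∀ x ∈ s, ω ∉ E x} ≤ ENNReal.ofReal (V / (s.card * p) ^ 2) := by
  set X : Ω → ℝ := fun ω => ∑ x ∈ s, (E x).indicator (1 : Ω → ℝ) ω with hX
  have hLp : ∀ x ∈ s, MemLp ((E x).indicator (1 : Ω → ℝ)) 2 μ :=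
    fun x _ => memLp_indicator_one (hE x)
  have hXLp : MemLp X 2 μ := memLp_finsetSum _ hLp
  have hvar : Var[X; μ] ≤ V := (variance_fun_sum' hLp).trans_le hV
  have hmean : s.card * p ≤ ∫ ω, X ω ∂μ := by
    rw [hX, integral_finsetSum _ fun x hx => (hLp x hx).integrable (by norm_num)]
    simp_rw [integral_indicator_one (hE _)]
    rw [← nsmul_eq_mul]
    exact Finset.card_nsmul_le_sum s _ p hpE
  have hc : 0 < s.card * p := mul_pos (by exact_mod_cast hs.card_pos) hp
  -- Chebyshev: if none of the events occurs, the count is 0 and deviates from its mean by at least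
  -- `s.card * p`.
  refine (measure_mono fun ω hω => ?_).trans ((meas_ge_le_variance_div_sq hXLp hc).trans
    (ENNReal.ofReal_le_ofReal (by gcongr)))
  have h0 : X ω = 0 := Finset.sum_eq_zero fun x hx => Set.indicator_of_notMem (hω x hx) _
  simp only [Set.mem_ofPred_eq, h0, zero_sub, abs_neg]
  exact hmean.trans (le_abs_self _)

end SecondMoment

open ProbabilityTheory

/-- No point lies in both strips. Separating the strips thus disposes of chained and reversed pairs,
whose covariance is then not positive. -/
lemma crossEvent_disjoint {d : Fin 2} {σ y s δ : ℝ} {a b a' b' : Fin n} (h : a = b' ∨ b = a') :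
    crossEvent d σ y s δ a b ∩ crossEvent d σ y s δ a' b' = ∅ := by
  ext P
  simp only [crossEvent, Crosses, Set.mem_inter_iff, Set.mem_ofPred_eq, Set.mem_empty_iff_false,
    iff_false]
  rintro ⟨⟨h1, h2, -⟩, h3, h4, -⟩
  rcases h with rfl | rfl
  · linarith [h1.2, h4.1]
  · linarith [h2.1, h3.2]

lemma covariance_crossEvent_le {d : Fin 2} {σ y s δ : ℝ} (hδ : 0 ≤ δ) {x z : Fin n × Fin n}
    (hx : x.1 ≠ x.2) (hz : z.1 ≠ z.2) :
    cov[(crossEvent d σ y s δ x.1 x.2).indicator (1 : (Fin n → Fin 2 → ℝ) → ℝ),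
      (crossEvent d σ y s δ z.1 z.2).indicator (1 : (Fin n → Fin 2 → ℝ) → ℝ); uniformSample n] ≤
      (if x = z then δ else 0) + (if x.1 = z.1 then 3 * δ ^ 2 else 0) +
        (if x.2 = z.2 then 3 * δ ^ 2 else 0) := by
  obtain ⟨a, b⟩ := x
  obtain ⟨a', b'⟩ := z
  simp only at hx hz ⊢
  have hm := fun a b : Fin n => measurableSet_crossEvent d σ y s δ a b
  have hle := covariance_indicator_le (μ := uniformSample n) (hm a b) (hm a' b')
  have hq : (0 : ℝ) ≤ 3 * δ ^ 2 := by positivity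
  by_cases h1 : a = a'
  · subst h1
    by_cases h2 : b = b'
    · subst h2
      refine hle.trans ?_
      rw [Set.inter_self]
      have := ENNReal.toReal_mono ENNReal.ofReal_ne_top
        (measure_crossEvent_le (n := n) (d := d) (σ := σ) (y := y) (s := s) hδ hx)
      rw [ENNReal.toReal_ofReal hδ] at this
      simp only [if_true]
      exact this.trans (by linarith)
    · refine hle.trans ?_
      have := ENNReal.toReal_mono ENNReal.ofReal_ne_top
        (measure_crossEvent_inter_fst_le (n := n) (d := d) (σ := σ) (y := y) (s := s) hδ hx hz h2)
      rw [ENNReal.toReal_ofReal hq] at this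
      simp only [if_true, h2, if_false, Prod.mk.injEq, and_false]
      exact this.trans (by linarith)
  · by_cases h2 : b = b'
    · subst h2
      refine hle.trans ?_
      have := ENNReal.toReal_mono ENNReal.ofReal_ne_top
        (measure_crossEvent_inter_snd_le (n := n) (d := d) (σ := σ) (y := y) (s := s) hδ hx hz h1)
      rw [ENNReal.toReal_ofReal hq] at this
      simp only [if_true, h1, if_false, Prod.mk.injEq, false_and]
      exact this.trans (by linarith)
    · simp only [h1, h2, if_false, Prod.mk.injEq, false_and, add_zero]
      by_cases h3 : a = b' ∨ b = a'
      · refine hle.trans ?_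
        rw [crossEvent_disjoint h3]
        simp
      · push Not at h3
        -- Four distinct points remain, and the two events are independent.
        have hind : iIndepFun (fun (i : Fin n) (P : Fin n → Fin 2 → ℝ) => P i) (uniformSample n) :=
          iIndepFun_pi (X := fun _ => id) fun _ => aemeasurable_id
        have h4 := hind.indepFun_prodMk_prodMk (fun i => measurable_pi_apply i) a b a' b'
          h1 h3.1 h3.2 h2
        have hind1 : Measurable ({p : (Fin 2 → ℝ) × (Fin 2 → ℝ) |
            Crosses d σ y s δ p.1 p.2}.indicator (1 : (Fin 2 → ℝ) × (Fin 2 → ℝ) → ℝ)) :=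
          measurable_one.indicator (measurableSet_crosses d σ y s δ)
        have h5 := h4.comp hind1 hind1
        exact (h5.covariance_eq_zero (memLp_indicator_one (hm a b))
          (memLp_indicator_one (hm a' b'))).le

/-- With high probability some line through two sample points crosses a given segment. -/
lemma measure_forall_not_crosses_le {d : Fin 2} {σ y s δ : ℝ}
    (hσ : (σ = 1 ∧ 0 ≤ y ∧ y ≤ 1 / 2) ∨ (σ = -1 ∧ 1 / 2 ≤ y ∧ y ≤ 1)) (hs : 0 ≤ s) (hδ : 0 < δ)
    (hsδ : s + δ ≤ 1) (hn : 3 ≤ n) (i : Fin n) :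
    uniformSample n {P | ∀ a b, a ≠ i → b ≠ i → a ≠ b → ¬ Crosses d σ y s δ (P a) (P b)} ≤
      ENNReal.ofReal (65536 * (1 + 6 * n * δ) / ((n - 1) * (n - 2) * δ)) := by
  set S : Finset (Fin n × Fin n) := (Finset.univ.erase i).offDiag with hS
  have hn' : (3 : ℝ) ≤ n := by exact_mod_cast hn
  have hcard : (S.card : ℝ) = (n - 1) * (n - 2) := by
    rw [hS, Finset.offDiag_card, Finset.card_erase_of_mem (Finset.mem_univ i), Finset.card_univ,
      Fintype.card_fin]
    obtain ⟨m, rfl⟩ : ∃ m, n = m + 3 := ⟨n - 3, by omega⟩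
    rw [show (m + 3 - 1) * (m + 3 - 1) - (m + 3 - 1) = (m + 2) * (m + 1) by
      rw [show m + 3 - 1 = m + 2 by omega]
      have : (m + 2) * (m + 2) = (m + 2) * (m + 1) + (m + 2) := by ring
      omega]
    push_cast; ring
  have hcpos : (0 : ℝ) < S.card := by rw [hcard]; exact mul_pos (by linarith) (by linarith)
  have hSne : S.Nonempty := Finset.card_pos.mp (by exact_mod_cast hcpos)
  have hmemS : ∀ x ∈ S, x.1 ≠ i ∧ x.2 ≠ i ∧ x.1 ≠ x.2 := by
    intro x hx
    rw [hS, Finset.mem_offDiag] at hx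
    exact ⟨Finset.ne_of_mem_erase hx.1, Finset.ne_of_mem_erase hx.2.1, hx.2.2⟩
  have hV : ∑ x ∈ S, ∑ z ∈ S, cov[
      (crossEvent d σ y s δ x.1 x.2).indicator (1 : (Fin n → Fin 2 → ℝ) → ℝ),
      (crossEvent d σ y s δ z.1 z.2).indicator (1 : (Fin n → Fin 2 → ℝ) → ℝ); uniformSample n] ≤
      S.card * (δ + 6 * n * δ ^ 2) := by
    -- A given pair shares its first point with at most `n` pairs, and its second one likewise,
    -- which bounds each row of covariances by `δ + 2 n (3 δ ^ 2)`.
    rw [← nsmul_eq_mul]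
    refine Finset.sum_le_card_nsmul S _ _ fun x hx => ?_
    refine (Finset.sum_le_sum fun z hz => covariance_crossEvent_le hδ.le (hmemS x hx).2.2
      (hmemS z hz).2.2).trans ?_
    rw [Finset.sum_add_distrib, Finset.sum_add_distrib, Finset.sum_ite_eq, if_pos hx,
      ← Finset.sum_filter, ← Finset.sum_filter, Finset.sum_const, Finset.sum_const]
    have h1 : ((S.filter fun z => x.1 = z.1).card : ℝ) ≤ n := by
      have := Finset.card_le_card_of_injOn (s := S.filter fun z => x.1 = z.1)
        (t := (Finset.univ : Finset (Fin n))) Prod.snd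
        (fun _ _ => Finset.mem_coe.mpr (Finset.mem_univ _)) ?_
      · rw [Finset.card_univ, Fintype.card_fin] at this
        exact_mod_cast this
      · intro z hz w hw h
        simp only [Finset.coe_filter, Set.mem_ofPred_eq] at hz hw
        exact Prod.ext (hz.2.symm.trans hw.2) h
    have h2 : ((S.filter fun z => x.2 = z.2).card : ℝ) ≤ n := by
      have := Finset.card_le_card_of_injOn (s := S.filter fun z => x.2 = z.2)
        (t := (Finset.univ : Finset (Fin n))) Prod.fst
        (fun _ _ => Finset.mem_coe.mpr (Finset.mem_univ _)) ?_
      · rw [Finset.card_univ, Fintype.card_fin] at this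
        exact_mod_cast this
      · intro z hz w hw h
        simp only [Finset.coe_filter, Set.mem_ofPred_eq] at hz hw
        exact Prod.ext h (hz.2.symm.trans hw.2)
    rw [nsmul_eq_mul, nsmul_eq_mul]
    nlinarith [sq_nonneg δ]
  have hpE : ∀ x ∈ S, δ / 256 ≤ (uniformSample n).real (crossEvent d σ y s δ x.1 x.2) := by
    intro x hx
    have := ENNReal.toReal_mono (measure_ne_top _ _)
      (le_measure_crossEvent hσ hs hδ.le hsδ (d := d) (hmemS x hx).2.2)
    rwa [ENNReal.toReal_ofReal (by positivity)] at this
  have := measure_forall_notMem_le (μ := uniformSample n) (s := S)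
    (E := fun x => crossEvent d σ y s δ x.1 x.2)
    (fun x => measurableSet_crossEvent d σ y s δ x.1 x.2) (by positivity : 0 < δ / 256) hSne hpE hV
  refine (measure_mono fun P hP x hx => ?_).trans (this.trans (ENNReal.ofReal_le_ofReal ?_))
  · obtain ⟨h1, h2, h3⟩ := hmemS x hx
    exact hP x.1 x.2 h1 h2 h3
  · rw [← hcard]
    refine le_of_eq ?_
    field_simp
    ring

/-- Averaging over a point of the sample amounts to averaging over an independent point, if the
other point does not matter. -/
lemma lintegral_eval_eq (i : Fin n) {F : (Fin n → Fin 2 → ℝ) → (Fin 2 → ℝ) → ℝ≥0∞}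
    (hF : Measurable (Function.uncurry F)) (hi : ∀ P q q', F (Function.update P i q) q' = F P q') :
    ∫⁻ P, F P (P i) ∂(uniformSample n) =
      ∫⁻ q, ∫⁻ P, F P q ∂(uniformSample n) ∂uniformSquare := by
  rw [lintegral_lintegral_swap]
  · unfold uniformSample
    refine lintegral_eq_of_lmarginal_eq (μ := fun _ : Fin n => uniformSquare) {i}
      (hF.comp (measurable_id.prodMk (measurable_pi_apply i))) hF.lintegral_prod_right' ?_
    rw [lmarginal_singleton, lmarginal_singleton]
    funext P
    simp [hi]
  · exact (hF.comp measurable_swap).aemeasurable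

/-! ### The lower bound -/

/-- The side of the line of ordinate `y` on which the unit square is the widest. -/
noncomputable def wideSide (y : ℝ) : ℝ := if y ≤ 1 / 2 then 1 else -1

lemma measurable_wideSide : Measurable wideSide :=
  Measurable.ite measurableSet_Iic measurable_const measurable_const

lemma wideSide_spec {y : ℝ} (hy : y ∈ Set.Icc (0 : ℝ) 1) :
    (wideSide y = 1 ∧ 0 ≤ y ∧ y ≤ 1 / 2) ∨ (wideSide y = -1 ∧ 1 / 2 ≤ y ∧ y ≤ 1) := by
  unfold wideSide
  split_ifs with h
  · exact Or.inl ⟨rfl, hy.1, h⟩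
  · exact Or.inr ⟨rfl, (not_le.mp h).le, hy.2⟩

/-- No line through two points other than `i` crosses the dyadic segment of length `2 ^ (-k)`
around `q` that is parallel to the axis `d`. -/
def missEvent (k : ℕ) (d : Fin 2) (i : Fin n) : Set ((Fin n → Fin 2 → ℝ) × (Fin 2 → ℝ)) :=
  {x | ∀ a b, a ≠ i → b ≠ i → a ≠ b → ¬ Crosses d (wideSide (x.2 (1 - d))) (x.2 (1 - d))
    (dyadicFloor k (x.2 d)) ((1 / 2) ^ k) (x.1 a) (x.1 b)}

lemma measurableSet_missEvent (k : ℕ) (d : Fin 2) (i : Fin n) :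
    MeasurableSet (missEvent k d i) := by
  have hq : ∀ c : Fin 2, Measurable fun x : (Fin n → Fin 2 → ℝ) × (Fin 2 → ℝ) => x.2 c :=
    fun c => (measurable_pi_apply c).comp measurable_snd
  have hp : ∀ (a : Fin n) (c : Fin 2),
      Measurable fun x : (Fin n → Fin 2 → ℝ) × (Fin 2 → ℝ) => x.1 a c :=
    fun a c => (measurable_eval_eval a c).comp measurable_fst
  have hh : ∀ a : Fin n, Measurable fun x : (Fin n → Fin 2 → ℝ) × (Fin 2 → ℝ) =>
      height d (wideSide (x.2 (1 - d))) (x.2 (1 - d)) (x.1 a) := fun a =>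
    (measurable_wideSide.comp (hq _)).mul ((hp a _).sub (hq _))
  have hs : Measurable fun x : (Fin n → Fin 2 → ℝ) × (Fin 2 → ℝ) => dyadicFloor k (x.2 d) :=
    (measurable_dyadicFloor k).comp (hq d)
  have hc : ∀ a b : Fin n, Measurable fun x : (Fin n → Fin 2 → ℝ) × (Fin 2 → ℝ) =>
      crossingPoint d (wideSide (x.2 (1 - d))) (x.2 (1 - d)) (x.1 a) (x.1 b) := fun a b =>
    (((hp a d).mul (hh b)).sub ((hp b d).mul (hh a))).div ((hh b).sub (hh a))
  have hX : ∀ a b : Fin n, MeasurableSet {x : (Fin n → Fin 2 → ℝ) × (Fin 2 → ℝ) |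
      Crosses d (wideSide (x.2 (1 - d))) (x.2 (1 - d)) (dyadicFloor k (x.2 d)) ((1 / 2) ^ k)
        (x.1 a) (x.1 b)} := fun a b =>
    (hh a measurableSet_Icc).inter ((hh b measurableSet_Icc).inter
      ((measurableSet_lt hs (hc a b)).inter (measurableSet_lt (hc a b) (hs.add_const _))))
  have : missEvent k d i = ⋂ (a : Fin n) (b : Fin n) (_ : a ≠ i) (_ : b ≠ i) (_ : a ≠ b),
      {x : (Fin n → Fin 2 → ℝ) × (Fin 2 → ℝ) | Crosses d (wideSide (x.2 (1 - d))) (x.2 (1 - d))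
        (dyadicFloor k (x.2 d)) ((1 / 2) ^ k) (x.1 a) (x.1 b)}ᶜ := by
    ext x; simp [missEvent]
  rw [this]
  exact MeasurableSet.iInter fun a => MeasurableSet.iInter fun b => MeasurableSet.iInter fun _ =>
    MeasurableSet.iInter fun _ => MeasurableSet.iInter fun _ => (hX a b).compl

/-- The points of the sample around which the dyadic segment of length `2 ^ (-k)` is missed. -/
def missedAt (k : ℕ) (d : Fin 2) (i : Fin n) : Set (Fin n → Fin 2 → ℝ) :=
  {P | (P, P i) ∈ missEvent k d i}

lemma measurableSet_missedAt (k : ℕ) (d : Fin 2) (i : Fin n) : MeasurableSet (missedAt k d i) :=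
  (measurable_id.prodMk (measurable_pi_apply i)) (measurableSet_missEvent k d i)

/-- The segment depends only on the point `i` and the lines only on the others, so this point can be
frozen and the estimate for a fixed segment applied uniformly. -/
lemma measure_missedAt_le (hn : 3 ≤ n) (k : ℕ) (d : Fin 2) (i : Fin n) :
    uniformSample n (missedAt k d i) ≤
      ENNReal.ofReal (65536 * (1 + 6 * n * (1 / 2) ^ k) / ((n - 1) * (n - 2) * (1 / 2) ^ k)) := by
  set F : (Fin n → Fin 2 → ℝ) → (Fin 2 → ℝ) → ℝ≥0∞ := fun P q =>
    (missEvent k d i).indicator 1 (P, q) with hF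
  have hFm : Measurable (Function.uncurry F) :=
    measurable_one.indicator (measurableSet_missEvent k d i)
  have hi : ∀ P q q', F (Function.update P i q) q' = F P q' := by
    intro P q q'
    have : (Function.update P i q, q') ∈ missEvent k d i ↔ (P, q') ∈ missEvent k d i := by
      simp only [missEvent, Set.mem_ofPred_eq]
      refine forall_congr' fun a => forall_congr' fun b => ?_
      refine imp_congr_right fun ha => imp_congr_right fun hb => imp_congr_right fun _ => ?_
      rw [Function.update_of_ne ha, Function.update_of_ne hb]
    by_cases h : (P, q') ∈ missEvent k d i
    · simp only [hF, Set.indicator_of_mem h, Set.indicator_of_mem (this.mpr h), Pi.one_apply]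
    · simp only [hF, Set.indicator_of_notMem h, Set.indicator_of_notMem (mt this.mp h)]
  have h1 : uniformSample n (missedAt k d i) = ∫⁻ P, F P (P i) ∂(uniformSample n) := by
    rw [← lintegral_indicator_one (measurableSet_missedAt k d i)]
    rfl
  rw [h1, lintegral_eval_eq i hFm hi]
  have hae : ∀ᵐ q ∂uniformSquare, q ∈ Set.Icc (0 : Fin 2 → ℝ) 1 :=
    ae_restrict_mem measurableSet_Icc
  refine (lintegral_mono_ae (g := fun _ => ENNReal.ofReal
    (65536 * (1 + 6 * n * (1 / 2) ^ k) / ((n - 1) * (n - 2) * (1 / 2) ^ k))) ?_).trans ?_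
  · filter_upwards [hae] with q hq
    have hm : MeasurableSet ((fun P : Fin n → Fin 2 → ℝ => (P, q)) ⁻¹' missEvent k d i) :=
      (measurable_id.prodMk measurable_const) (measurableSet_missEvent k d i)
    refine le_trans (le_of_eq (lintegral_indicator_one hm)) ?_
    exact measure_forall_not_crosses_le (wideSide_spec ⟨hq.1 _, hq.2 _⟩) (dyadicFloor_nonneg k _)
      (by positivity) (dyadicFloor_add_le_one k _) hn i
  · rw [lintegral_const, measure_univ, mul_one]

/-- Every algorithm that determines the chirotope reads more than `k` bits of each coordinate
that is not missed. -/
lemma DeterminesChirotope.le_averageBits {A : Algorithm n} (hA : DeterminesChirotope A) (k : ℕ) :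
    ∑ i, ∑ d, ((k + 1 : ℕ) : ℝ≥0∞) * uniformSample n (missedAt k d i)ᶜ ≤ averageBits A := by
  have hm := fun d (i : Fin n) => (measurableSet_missedAt k d i).compl
  have h1 : ∑ i, ∑ d, ((k + 1 : ℕ) : ℝ≥0∞) * uniformSample n (missedAt k d i)ᶜ =
      ∫⁻ P, ∑ i, ∑ d, (missedAt k d i)ᶜ.indicator (fun _ => ((k + 1 : ℕ) : ℝ≥0∞)) P
        ∂(uniformSample n) := by
    rw [lintegral_finsetSum _ fun i _ => Finset.measurable_sum _ fun d _ =>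
      measurable_const.indicator (hm d i)]
    refine Finset.sum_congr rfl fun i _ => ?_
    rw [lintegral_finsetSum _ fun d _ => measurable_const.indicator (hm d i)]
    refine Finset.sum_congr rfl fun d _ => ?_
    rw [lintegral_indicator_const (hm d i)]
  rw [h1]
  refine lintegral_mono_ae ?_
  filter_upwards [hA, ae_mem_Icc, ae_notMem_dyadicEnds] with P hout hP hd
  obtain ⟨t, ht⟩ := hout
  refine le_trans ?_ (sum_length_le_bitsRead A (inputOf P) t)
  push_cast
  refine Finset.sum_le_sum fun i _ => Finset.sum_le_sum fun d _ => ?_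
  by_cases hmem : P ∈ (missedAt k d i)ᶜ
  swap
  · rw [Set.indicator_of_notMem hmem]; exact zero_le
  rw [Set.indicator_of_mem hmem]
  have hmem' : ¬ ∀ a b, a ≠ i → b ≠ i → a ≠ b → ¬ Crosses d (wideSide (P i (1 - d)))
      (P i (1 - d)) (dyadicFloor k (P i d)) ((1 / 2) ^ k) (P a) (P b) := hmem
  push Not at hmem'
  obtain ⟨a, b, hai, hbi, -, hcross⟩ := hmem'
  have := hA.lt_length_of_crosses hP hd hai hbi hcross ht
  exact_mod_cast this

/-- From `9 ≥ 8` and `9/4 ≥ 2`. A positive lower bound on `log log n` lets the final constant absorb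
terms of order `n`. -/
lemma half_le_logb_logb {n : ℕ} (hn : 3 ≤ n) :
    3 / 2 ≤ Real.logb 2 n ∧ 1 / 2 ≤ Real.logb 2 (Real.logb 2 n) := by
  have hn' : (3 : ℝ) ≤ n := by exact_mod_cast hn
  have h1 : 3 / 2 ≤ Real.logb 2 n := by
    have h2 : Real.logb 2 ((2 : ℝ) ^ 3) ≤ Real.logb 2 ((n : ℝ) ^ 2) :=
      Real.logb_le_logb_of_le (by norm_num) (by norm_num) (by nlinarith)
    rw [Real.logb_pow, Real.logb_pow, Real.logb_self_eq_one (by norm_num)] at h2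
    push_cast at h2
    linarith
  refine ⟨h1, ?_⟩
  have h2 : Real.logb 2 2 ≤ Real.logb 2 ((Real.logb 2 n) ^ 2) :=
    Real.logb_le_logb_of_le (by norm_num) (by norm_num) (by nlinarith)
  rw [Real.logb_pow, Real.logb_self_eq_one (by norm_num)] at h2
  push_cast at h2
  linarith

/-- The resolution `k` for which `2 ^ (-k)` is about `log n / n ^ 2`. -/
lemma exists_resolution {n : ℕ} (hn : 3 ≤ n) : ∃ k : ℕ,
    2 * Real.logb 2 n - Real.logb 2 (Real.logb 2 n) ≤ k + 1 ∧
    Real.logb 2 n ≤ n ^ 2 * (1 / 2) ^ k ∧ n * (1 / 2 : ℝ) ^ k ≤ 2 := by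
  obtain ⟨hL, hl⟩ := half_le_logb_logb hn
  have hn' : (3 : ℝ) ≤ n := by exact_mod_cast hn
  set L := Real.logb 2 n with hLdef
  set l := Real.logb 2 L with hldef
  have hLn : L ≤ n := by
    rw [hLdef, Real.logb_le_iff_le_rpow (by norm_num) (by linarith), Real.rpow_natCast]
    exact_mod_cast Nat.lt_two_pow_self.le
  have hlL : l ≤ L := Real.logb_le_logb_of_le (by norm_num) (by linarith) hLn
  have h2L : (2 : ℝ) ^ L = n := Real.rpow_logb (by norm_num) (by norm_num) (by linarith)
  have h2l : (2 : ℝ) ^ l = L := Real.rpow_logb (by norm_num) (by norm_num) (by linarith)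
  have hexp : (2 : ℝ) ^ (2 * L - l) = n ^ 2 / L := by
    rw [Real.rpow_sub (by norm_num), h2l, mul_comm, Real.rpow_mul (by norm_num), h2L]
    norm_num
  -- Then `2 ^ k ≤ n ^ 2 / L ≤ 2 ^ (k + 1)`: the first inequality provides enough crossing lines,
  -- the second, with `L ≤ n`, keeps the correlation term `n * 2 ^ (-k)` bounded.
  set k := ⌊2 * L - l⌋₊ with hk
  have hk1 : (k : ℝ) ≤ 2 * L - l := Nat.floor_le (by linarith)
  have hk2 : 2 * L - l < k + 1 := Nat.lt_floor_add_one _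
  have h3 : (2 : ℝ) ^ k ≤ n ^ 2 / L := by
    rw [← hexp, ← Real.rpow_natCast]
    exact Real.rpow_le_rpow_of_exponent_le (by norm_num) hk1
  have h4 : n ^ 2 / L ≤ (2 : ℝ) ^ k * 2 := by
    rw [← hexp, ← pow_succ, ← Real.rpow_natCast]
    exact Real.rpow_le_rpow_of_exponent_le (by norm_num) (by push_cast; exact hk2.le)
  have hLpos : 0 < L := by linarith
  have h2k : (0 : ℝ) < 2 ^ k := by positivity
  refine ⟨k, hk2.le, ?_, ?_⟩
  · rw [one_div, inv_pow, ← div_eq_mul_inv, le_div_iff₀ h2k]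
    rw [le_div_iff₀ hLpos] at h3
    linarith
  · rw [one_div, inv_pow, ← div_eq_mul_inv, div_le_iff₀ h2k]
    rw [div_le_iff₀ hLpos] at h4
    have h5 : (n : ℝ) * n ≤ (2 * 2 ^ k) * n := by
      calc (n : ℝ) * n = n ^ 2 := by ring
        _ ≤ 2 ^ k * 2 * L := h4
        _ ≤ 2 ^ k * 2 * n := by gcongr
        _ = _ := by ring
    exact le_of_mul_le_mul_right h5 (by linarith)

theorem exists_lower_bound : ∃ C : ℝ, ∀ n : ℕ, 3 ≤ n → ∀ A : Algorithm n, DeterminesChirotope A →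
    ENNReal.ofReal (4 * n * Real.logb 2 n - C * (n * Real.logb 2 (Real.logb 2 n)))
      ≤ averageBits A := by
  -- The factors are `256 ^ 2` from Chebyshev, `1 + 6 * 2` from `n δ ≤ 2`, and 5 from `n ^ 2 ≤ 5 (n
  -- - 1) (n - 2)`.
  set c : ℝ := 65536 * 13 * 5 with hc
  -- Twice the loss `l + 2 * c` per coordinate is at most `(2 + 8 * c) * l`, because `l ≥ 1/2`.
  refine ⟨2 + 8 * c, fun n hn A hA => ?_⟩
  obtain ⟨hL, hl⟩ := half_le_logb_logb hn
  obtain ⟨k, hk1, hk2, hk3⟩ := exists_resolution hn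
  have hn' : (3 : ℝ) ≤ n := by exact_mod_cast hn
  set L := Real.logb 2 n with hLdef
  set l := Real.logb 2 L with hldef
  have hLpos : 0 < L := by linarith
  have hδ : (0 : ℝ) < (1 / 2) ^ k := by positivity
  have hmiss : ∀ (d : Fin 2) (i : Fin n),
      uniformSample n (missedAt k d i) ≤ ENNReal.ofReal (c / L) := by
    intro d i
    refine (measure_missedAt_le hn k d i).trans (ENNReal.ofReal_le_ofReal ?_)
    generalize ((1 : ℝ) / 2) ^ k = δ at *
    have h1 : (n : ℝ) ^ 2 ≤ 5 * ((n - 1) * (n - 2)) := by nlinarith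
    have h2 : L ≤ 5 * ((n - 1) * (n - 2) * δ) := by nlinarith
    rw [div_le_div_iff₀ (by nlinarith) hLpos, hc]
    have h3 : 1 + 6 * n * δ ≤ 13 := by linarith
    have h4 : (1 + 6 * n * δ) * L ≤ 13 * L := by gcongr
    nlinarith
  have hgood : ∀ (d : Fin 2) (i : Fin n),
      ENNReal.ofReal (1 - c / L) ≤ uniformSample n (missedAt k d i)ᶜ := by
    intro d i
    rw [prob_compl_eq_one_sub (measurableSet_missedAt k d i),
      ENNReal.ofReal_sub _ (by positivity), ENNReal.ofReal_one]
    exact tsub_le_tsub_left (hmiss d i) 1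
  refine le_trans ?_ (hA.le_averageBits k)
  have hsum : ENNReal.ofReal (n * (2 * ((k + 1) * (1 - c / L)))) ≤
      ∑ i : Fin n, ∑ d, ((k + 1 : ℕ) : ℝ≥0∞) * uniformSample n (missedAt k d i)ᶜ := by
    refine le_trans (le_of_eq ?_) (Finset.sum_le_sum fun i _ => Finset.sum_le_sum fun d _ =>
      mul_le_mul_right (hgood d i) _)
    simp only [Finset.sum_const, Finset.card_univ, Fintype.card_fin, nsmul_eq_mul]
    rw [ENNReal.ofReal_mul (by positivity), ENNReal.ofReal_mul (by norm_num),
      ENNReal.ofReal_mul (by positivity), ENNReal.ofReal_natCast]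
    congr 3
    · simp
    · exact_mod_cast ENNReal.ofReal_natCast (k + 1)
  refine le_trans ?_ hsum
  -- For `L ≤ c` the probability bound is void, but then the claimed bound is not positive.
  rcases le_total L c with hcL | hcL
  · rw [ENNReal.ofReal_of_nonpos]
    · exact zero_le
    · have : 4 * L ≤ (2 + 8 * c) * l := by nlinarith
      nlinarith
  · refine ENNReal.ofReal_le_ofReal ?_
    have h1 : 0 ≤ 1 - c / L := by
      rw [sub_nonneg, div_le_one hLpos]; exact hcL
    have h2 : (2 * L - l) * (1 - c / L) ≤ (k + 1) * (1 - c / L) :=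
      mul_le_mul_of_nonneg_right hk1 h1
    have h3 : (2 * L - l) * (1 - c / L) = 2 * L - l - 2 * c + l * (c / L) := by
      field_simp; ring
    have h4 : 0 ≤ l * (c / L) := mul_nonneg (by linarith) (by positivity)
    have h5 : 4 * L - (2 + 8 * c) * l ≤ 2 * ((k + 1) * (1 - c / L)) := by
      nlinarith
    nlinarith

end BitModel

theorem theorem1 :
    -- (i) every algorithm that determines the chirotope
    (∃ C : ℝ, ∀ n : ℕ, 3 ≤ n → ∀ A : Algorithm n, DeterminesChirotope A →
      ENNReal.ofReal (4 * n * Real.logb 2 n - C * (n * Real.logb 2 (Real.logb 2 n)))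
        ≤ averageBits A) ∧
    -- (ii) there is a greedy algorithm
    (∃ A : ∀ n, Algorithm n, UniformlyComputable A ∧ ∀ n, IsGreedy (A n)) ∧
    -- and every greedy algorithm, whatever its rule to break ties, has the required properties
    (∀ (n : ℕ) (A : Algorithm n), IsGreedy A →
      DeterminesChirotope A ∧
      (∀ w : Input n, InGeneralPosition w.points → Outputs A w (chirotope w.points)) ∧
      averageBits A ≤ ENNReal.ofReal (4 * n * Real.logb 2 n + 16 * n)) :=
  ⟨exists_lower_bound,
    ⟨greedyAlgorithm, uniformlyComputable_greedyAlgorithm, isGreedy_greedyAlgorithm⟩,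
    fun _ _ hA => ⟨hA.determinesChirotope, hA.outputs_of_inGeneralPosition, hA.averageBits_le⟩⟩
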